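/- Let $M$ be a $(2n+1)$-dimensional smooth manifold with a contact metric structure $(\varphi,\xi,\eta,g)$: a smooth $(1,1)$-tensor field $\varphi$, vector field $\xi$, $1$-form $\eta$ and Riemannian metric $g$ such that $$\varphi^2=-I+\eta\otimes\xi,\quad \eta(\xi)=1,\quad g(\varphi X,\varphi Y)=g(X,Y)-\eta(X)\eta(Y),\quad d\eta(X,Y)=g(X,\varphi Y),$$ where $d\eta(X,Y)=\tfrac12\big(X\eta(Y)-Y\eta(X)-\eta([X,Y])\big)$. Let $\nabla$ be its Levi-Civita connection, $R(X,Y)Z=\nabla_X\nabla_YZ-\nabla_Y\nabla_XZ-\nabla_{[X,Y]}Z$, and $h=\tfrac12L_\xi\varphi$. Assume that $M$ is a $(\kappa,\mu)$-space, i.e. that for some real constants $\kappa,\mu$ $$R(X,Y)\xi=\kappa\,(\eta(Y)X-\eta(X)Y)+\mu\,(\eta(Y)hX-\eta(X)hY)$$ for all vector fields $X,Y$ on $M$. Let $N$ be a Legendrian submanifold of $M$, i.e. an isometrically immersed $n$-dimensional submanifold to which $\xi$ is normal; let $\overline\nabla$ be the Levi-Civita connection of $N$ and $\sigma(X,Y)=\nabla_XY-\overline\nabla_XY$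 its second fundamental form. For $X$ tangent to $N$, let $h_1X$ be the tangential component of $hX$ and let $h_2X$ be the tangent vector such that $\varphi h_2X$ is the normal component of $hX$. Then $hX=h_1X+\varphi h_2X$ with smooth tensor fields $h_1,h_2$ on $N$, the vector $\varphi\sigma(X,Y)$ is tangent to $N$, and, for all vector fields $X,Y$ tangent to $N$, $$(\overline\nabla_Xh_1)Y=-\varphi\sigma(X,h_2Y)-h_2\varphi\sigma(X,Y),$$ $$(\overline\nabla_Xh_2)Y=\varphi\sigma(X,h_1Y)+h_1\varphi\sigma(X,Y),$$ $$g(\sigma(X,Y),\xi)+g(X,h_2Y)=0,$$ where $(\overline\nabla_XA)Y=\overline\nabla_X(AY)-A(\overline\nabla_XY)$. -/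

import Mathlib

open Bundle VectorField
open scoped Manifold
open scoped ContDiff

set_option linter.unusedSectionVars false

namespace ContactGeometry

noncomputable section

variable {E : Type*} [NormedAddCommGroup E] [NormedSpace ℝ E]
  {H : Type*} [TopologicalSpace H] {I : ModelWithCorners ℝ E H}
  {M : Type*} [TopologicalSpace M] [ChartedSpace H M]

instance [FiniteDimensional ℝ E] (x : M) : FiniteDimensional ℝ (TangentSpace I x) :=
  inferInstanceAs (FiniteDimensional ℝ E)

instance (x : M) : T2Space (TangentSpace I x) := inferInstanceAs (T2Space E)

variable [IsManifold I ∞ M]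

variable (I M) in
/-- A smooth Riemannian metric on the manifold `M`. -/
abbrev Metric : Type _ := ContMDiffRiemannianMetric I ∞ E (fun x : M ↦ TangentSpace I x)

/-- The vector field `X` is smooth at `x`. -/
def SmoothAt (X : Π x : M, TangentSpace I x) (x : M) : Prop := CMDiffAt ∞ (T% X) x

variable (g : Metric I M)

lemma Metric.mdiff {X Y : Π x : M, TangentSpace I x} {x : M} (hX : MDiffAt (T% X) x)
    (hY : MDiffAt (T% Y) x) : MDiffAt (fun y ↦ g.inner y (X y) (Y y)) x := by
  have : MDifferentiableAt I (I.prod 𝓘(ℝ)) 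
      (fun m ↦ TotalSpace.mk' ℝ (E := Bundle.Trivial M ℝ) m (g.inner m (X m) (Y m))) x := by
    apply MDifferentiableAt.clm_bundle_apply₂ (F₁ := E) (F₂ := E)
    · exact (g.contMDiff x).mdifferentiableAt (by simp)
    · exact hX
    · exact hY
  simp only [mdifferentiableAt_totalSpace] at this
  exact this.2

variable [FiniteDimensional ℝ E]

/-- The isomorphism `T_x M ≃ (T_x M)^*` given by the metric. -/
def flat (x : M) : TangentSpace I x ≃ₗ[ℝ] (TangentSpace I x →L[ℝ] ℝ) :=
  LinearEquiv.ofInjectiveOfFinrankEq (g.inner x).toLinearMap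
    (by
      refine (injective_iff_map_eq_zero _).2 fun v hv ↦ ?_
      by_contra h
      have := g.pos x v h
      rw [show g.inner x v = 0 from hv] at this
      simp at this)
    (by
      rw [← (LinearMap.toContinuousLinearMap : (TangentSpace I x →ₗ[ℝ] ℝ) ≃ₗ[ℝ] _).finrank_eq]
      exact (Subspace.dual_finrank_eq).symm)

/-- The vector `α^♯ ∈ T_x M` with `g(α^♯, v) = α(v)` for all `v`. -/
def sharp (x : M) : (TangentSpace I x →L[ℝ] ℝ) →L[ℝ] TangentSpace I x :=
  LinearMap.toContinuousLinearMap (flat g x).symm.toLinearMap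

@[simp] lemma inner_sharp (x : M) (α : TangentSpace I x →L[ℝ] ℝ) (v : TangentSpace I x) :
    g.inner x (sharp g x α) v = α v :=
  congrArg (fun a : TangentSpace I x →L[ℝ] ℝ ↦ a v) ((flat g x).apply_symm_apply α)

lemma Metric.ext_inner {x : M} {u v : TangentSpace I x}
    (h : ∀ w, g.inner x u w = g.inner x v w) : u = v :=
  (flat g x).injective (ContinuousLinearMap.ext h)

/-- Half of the right-hand side of Koszul's formula for `g(∇_X Y, Z)` at `x`. -/
def koszul (X Y Z : Π x : M, TangentSpace I x) (x : M) : ℝ :=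
  (1 / 2 : ℝ) *
    (d% (fun y ↦ g.inner y (Y y) (Z y)) x (X x) + d% (fun y ↦ g.inner y (X y) (Z y)) x (Y x)
      - d% (fun y ↦ g.inner y (X y) (Y y)) x (Z x)
      + g.inner x (mlieBracket I X Y x) (Z x) - g.inner x (mlieBracket I X Z x) (Y x)
      - g.inner x (mlieBracket I Y Z x) (X x))

variable {g} {x : M} {X Y Z X' Y' Z' : Π x : M, TangentSpace I x} 

lemma koszul_tensorial₁ (hY : MDiffAt (T% Y) x) (hZ : MDiffAt (T% Z) x) :
    TensorialAt I E (fun X ↦ koszul g X Y Z x) x where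
  smul {f X} hf hX := by
    simp [koszul, mvfderiv_fun_mul hf (g.mdiff hX hZ), mvfderiv_fun_mul hf (g.mdiff hX hY),
      mlieBracket_smul_left hf hX]
    ring
  add {X X'} hX hX' := by
    simp [koszul, mvfderiv_fun_add (g.mdiff hX hZ) (g.mdiff hX' hZ),
      mvfderiv_fun_add (g.mdiff hX hY) (g.mdiff hX' hY), mlieBracket_add_left hX hX']
    ring

lemma koszul_tensorial₂ (hY : MDiffAt (T% Y) x) (hX : MDiffAt (T% X) x) :
    TensorialAt I E (fun Z ↦ koszul g X Y Z x) x where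
  smul {f Z} hf hZ := by
    simp [koszul, mvfderiv_fun_mul hf (g.mdiff hX hZ), mvfderiv_fun_mul hf (g.mdiff hY hZ),
      mlieBracket_smul_right hf hZ]
    rw [g.symm x (Z x) (Y x), g.symm x (Z x) (X x)]
    ring
  add {Z Z'} hZ hZ' := by
    simp [koszul, mvfderiv_fun_add (g.mdiff hX hZ) (g.mdiff hX hZ'),
      mvfderiv_fun_add (g.mdiff hY hZ) (g.mdiff hY hZ'), mlieBracket_add_right hZ hZ']
    ring

variable (g) in
open Classical in
/-- The linear map `X ↦ ∇_X Y` at `x`, determined by Koszul's formula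
(and set to `0` if `Y` is not differentiable at `x`). -/
def leviCivitaAux (Y : Π x : M, TangentSpace I x) (x : M) :
    TangentSpace I x →L[ℝ] TangentSpace I x :=
  if hY : MDiffAt (T% Y) x then
    sharp g x ∘L TensorialAt.mkHom₂ (fun X Z ↦ koszul g X Y Z x) x
      (fun _ hZ ↦ koszul_tensorial₁ hY hZ) (fun _ hX ↦ koszul_tensorial₂ hY hX)
  else 0

lemma inner_leviCivitaAux (hX : MDiffAt (T% X) x) (hY : MDiffAt (T% Y) x) (hZ : MDiffAt (T% Z) x) :
    g.inner x (leviCivitaAux g Y x (X x)) (Z x) = koszul g X Y Z x := by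
  rw [leviCivitaAux, dif_pos hY]
  rw [ContinuousLinearMap.comp_apply, inner_sharp, TensorialAt.mkHom₂_apply _ _ hX hZ]

lemma leviCivitaAux_ext {A B : TangentSpace I x →L[ℝ] TangentSpace I x} 
    (h : ∀ X Z : Π x : M, TangentSpace I x, MDiffAt (T% X) x → MDiffAt (T% Z) x →
      g.inner x (A (X x)) (Z x) = g.inner x (B (X x)) (Z x)) : A = B := by
  ext1 u
  refine g.ext_inner fun w ↦ ?_
  have := h (FiberBundle.extend E u) (FiberBundle.extend E w) (FiberBundle.mdifferentiableAt_extend ..)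
    (FiberBundle.mdifferentiableAt_extend ..)
  simpa using this

variable (g) in
/-- The Levi-Civita connection of the metric `g`. -/
def leviCivita : CovariantDerivative I E (fun x : M ↦ TangentSpace I x) where
  toFun := leviCivitaAux g
  isCovariantDerivativeOnUniv :=
    { add := by
        intro Y Y' x hY hY' _
        refine leviCivitaAux_ext (g := g) fun X Z hX hZ ↦ ?_
        rw [inner_leviCivitaAux hX (mdifferentiableAt_add_section hY hY') hZ]
        simp only [add_apply, map_add, inner_leviCivitaAux hX hY hZ,
          inner_leviCivitaAux hX hY' hZ]
        simp [koszul, mvfderiv_fun_add (g.mdiff hX hY) (g.mdiff hX hY'),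
          mvfderiv_fun_add (g.mdiff hY hZ) (g.mdiff hY' hZ), mlieBracket_add_right hY hY',
          mlieBracket_add_left hY hY']
        ring
      leibniz := by
        intro Y f x hY hf _
        refine leviCivitaAux_ext (g := g) fun X Z hX hZ ↦ ?_
        rw [inner_leviCivitaAux hX (MDifferentiableAt.smul_section hf hY) hZ]
        simp only [add_apply, map_add, map_smul, smul_apply,
          inner_leviCivitaAux hX hY hZ]
        simp [koszul, mvfderiv_fun_mul hf (g.mdiff hX hY), mvfderiv_fun_mul hf (g.mdiff hY hZ),
          mlieBracket_smul_right hf hY, mlieBracket_smul_left hf hY]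
        rw [g.symm x (Y x) (X x)]
        ring }

lemma inner_leviCivita (hX : MDiffAt (T% X) x) (hY : MDiffAt (T% Y) x) (hZ : MDiffAt (T% Z) x) :
    g.inner x (leviCivita g Y x (X x)) (Z x) = koszul g X Y Z x :=
  inner_leviCivitaAux hX hY hZ

lemma leviCivita_torsion (hX : MDiffAt (T% X) x) (hY : MDiffAt (T% Y) x) :
    leviCivita g Y x (X x) - leviCivita g X x (Y x) = mlieBracket I X Y x := by
  refine g.ext_inner fun w ↦ ?_
  have hZ : MDiffAt (T% (FiberBundle.extend E w)) x := FiberBundle.mdifferentiableAt_extend ..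
  have h1 := inner_leviCivita (g := g) hX hY hZ
  have h2 := inner_leviCivita (g := g) hY hX hZ
  simp only [FiberBundle.extend_apply_self] at h1 h2
  simp only [map_sub, sub_apply, h1, h2]
  simp only [koszul, FiberBundle.extend_apply_self, mlieBracket_swap_apply (V := Y) (W := X),
    fun y ↦ g.symm y (Y y) (X y), map_neg, neg_apply]
  ring

lemma leviCivita_metric (hX : MDiffAt (T% X) x) (hY : MDiffAt (T% Y) x) (hZ : MDiffAt (T% Z) x) :
    d% (fun y ↦ g.inner y (Y y) (Z y)) x (X x) =
      g.inner x (leviCivita g Y x (X x)) (Z x) + g.inner x (Y x) (leviCivita g Z x (X x)) := by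
  rw [g.symm x (Y x), inner_leviCivita hX hY hZ, inner_leviCivita hX hZ hY]
  simp only [koszul, mlieBracket_swap_apply (V := Z) (W := Y), map_neg,
    neg_apply, fun y ↦ g.symm y (Z y) (Y y)]
  ring

variable (g) in
/-- The curvature `R(X,Y)Z = ∇_X ∇_Y Z - ∇_Y ∇_X Z - ∇_[X,Y] Z` at `x`. -/
def curvature (X Y Z : Π x : M, TangentSpace I x) (x : M) : TangentSpace I x :=
  leviCivita g (fun y ↦ leviCivita g Z y (Y y)) x (X x)
    - leviCivita g (fun y ↦ leviCivita g Z y (X y)) x (Y x)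
    - leviCivita g Z x (mlieBracket I X Y x)

variable (g) in
/-- `(∇_X A)Y = ∇_X (A Y) - A (∇_X Y)` at `x`, for a field `A` of endomorphisms of `TM`. -/
def covDerivEndo (A : Π x : M, TangentSpace I x →L[ℝ] TangentSpace I x)
    (X Y : Π x : M, TangentSpace I x) (x : M) : TangentSpace I x :=
  leviCivita g (fun y ↦ A y (Y y)) x (X x) - A x (leviCivita g Y x (X x))

variable (g) in
/-- A smooth almost contact structure `(φ, ξ, η)` on `M` for which the metric `g` is compatible. -/
structure AlmostContactMetric where
  φ : Π x : M, TangentSpace I x →L[ℝ] TangentSpace I x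
  ξ : Π x : M, TangentSpace I x
  η : Π x : M, TangentSpace I x →L[ℝ] ℝ
  smooth_φ : ContMDiff I (I.prod 𝓘(ℝ, E →L[ℝ] E)) ∞
    (fun x ↦ TotalSpace.mk' (E →L[ℝ] E)
      (E := fun x : M ↦ TangentSpace I x →L[ℝ] TangentSpace I x) x (φ x))
  smooth_ξ : CMDiff ∞ (T% ξ)
  smooth_η : ContMDiff I (I.prod 𝓘(ℝ, E →L[ℝ] ℝ)) ∞
    (fun x ↦ TotalSpace.mk' (E →L[ℝ] ℝ) (E := fun x : M ↦ TangentSpace I x →L[ℝ] ℝ) x (η x))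
  φ_sq : ∀ (x : M) (v : TangentSpace I x), φ x (φ x v) = -v + η x v • ξ x
  η_ξ : ∀ x : M, η x (ξ x) = 1
  compat : ∀ (x : M) (u v : TangentSpace I x),
    g.inner x (φ x u) (φ x v) = g.inner x u v - η x u * η x v

namespace AlmostContactMetric

variable (S : AlmostContactMetric g)

/-- The structure is *contact metric* if `dη = Φ`, where `Φ(X,Y) = g(X, φY)` and
`dη(X,Y) = (X(η(Y)) - Y(η(X)) - η([X,Y])) / 2`. -/
def IsContactMetric : Prop :=
  ∀ (x : M) (X Y : Π x : M, TangentSpace I x), SmoothAt X x → SmoothAt Y x →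
    (1 / 2 : ℝ) * (d% (fun y ↦ S.η y (Y y)) x (X x) - d% (fun y ↦ S.η y (X y)) x (Y x)
      - S.η x (mlieBracket I X Y x)) = g.inner x (X x) (S.φ x (Y x))

lemma mdiff_φ (hX : MDiffAt (T% X) x) : MDiffAt (T% (fun y ↦ S.φ y (X y))) x :=
  MDifferentiableAt.clm_bundle_apply (F₁ := E) (F₂ := E)
    ((S.smooth_φ x).mdifferentiableAt (by simp)) hX

lemma lie_tensorial (x : M) : TensorialAt I E
    (fun X : Π x : M, TangentSpace I x ↦ (1 / 2 : ℝ) •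
      (mlieBracket I S.ξ (fun y ↦ S.φ y (X y)) x - S.φ x (mlieBracket I S.ξ X x))) x where
  smul {f X} hf hX := by
    have h1 : (fun y ↦ S.φ y ((f • X) y)) = f • fun y ↦ S.φ y (X y) := by
      ext y; simp
    rw [h1, mlieBracket_smul_right hf (S.mdiff_φ hX), mlieBracket_smul_right hf hX]
    simp only [map_add, map_smul]
    module
  add {X X'} hX hX' := by
    have h1 : (fun y ↦ S.φ y ((X + X') y)) = (fun y ↦ S.φ y (X y)) + fun y ↦ S.φ y (X' y) := by
      ext y; simp
    rw [h1, mlieBracket_add_right (S.mdiff_φ hX) (S.mdiff_φ hX'), mlieBracket_add_right hX hX']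
    simp only [map_add]
    module

/-- The tensor field `h = (1/2) L_ξ φ`, i.e. `h X = (1/2) ([ξ, φX] - φ[ξ, X])`. -/
def h (x : M) : TangentSpace I x →L[ℝ] TangentSpace I x :=
  TensorialAt.mkHom _ x (S.lie_tensorial x)

lemma h_apply (hX : MDiffAt (T% X) x) : S.h x (X x) = (1 / 2 : ℝ) •
    (mlieBracket I S.ξ (fun y ↦ S.φ y (X y)) x - S.φ x (mlieBracket I S.ξ X x)) :=
  TensorialAt.mkHom_apply _ hX

/-- `M` with the structure `S` is a (contact metric) `(κ,μ)`-space. -/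
structure IsKappaMuSpace (κ μ : ℝ) : Prop where
  contact : S.IsContactMetric
  curvature_ξ : ∀ (x : M) (X Y : Π x : M, TangentSpace I x),
    SmoothAt X x → SmoothAt Y x →
    curvature g X Y S.ξ x =
      κ • (S.η x (Y x) • X x - S.η x (X x) • Y x) +
      μ • (S.η x (Y x) • S.h x (X x) - S.η x (X x) • S.h x (Y x))

end AlmostContactMetric

/-! ### Isometrically immersed submanifolds -/

variable {E' : Type*} [NormedAddCommGroup E'] [NormedSpace ℝ E'] [FiniteDimensional ℝ E']
  {H' : Type*} [TopologicalSpace H'] {J : ModelWithCorners ℝ E' H'}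
  {N : Type*} [TopologicalSpace N] [ChartedSpace H' N] [IsManifold J ∞ N]

variable (g) in
/-- The covariant derivative `∇_u V` (`u ∈ T_p N`) of a vector field `V` along `f : N → M`,
with respect to the Levi-Civita connection of `M`. Let `e_i` be the local frame of `TM` near `f p`
given by a trivialization. If `V = ∑ V^i e_i` along `f`, then
`∇_u V = ∑ dV^i(u) e_i + ∑ V^i(p) ∇_{df(u)} e_i`. The section
`∑ V^i(p) e_i`, with constant coefficients, is `FiberBundle.extend E (V p)`. -/
def covDerivAlong (f : N → M) (V : Π q : N, TangentSpace I (f q)) (p : N) (u : TangentSpace J p) :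
    TangentSpace I (f p) :=
  let t := trivializationAt E (fun x : M ↦ TangentSpace I x) (f p)
  t.symm (f p) (d% (fun q ↦ (t (TotalSpace.mk' E (f q) (V q))).2) p u)
    + leviCivita g (FiberBundle.extend E (V p)) (f p) (mfderiv J I f p u)

variable (gN : Metric J N)

variable (g) in
/-- The second fundamental form `σ(X,Y) = ∇_X Y - ∇̄_X Y` at `p` (Gauss formula), where `∇` and `∇̄`
are the Levi-Civita connections of `M` and `N`. -/
def secondFF (f : N → M) (X Y : Π q : N, TangentSpace J q) (p : N) : TangentSpace I (f p) :=
  covDerivAlong g f (fun q ↦ mfderiv J I f q (Y q)) p (X p)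
    - mfderiv J I f p (leviCivita gN Y p (X p))

variable (g) in
/-- The adjoint `T_{f p} M → T_p N` of `df_p`. When `f` is an isometric immersion, it sends a vector
to its tangential component, seen as a vector of `T_p N`. -/
def tangential (f : N → M) (p : N) : TangentSpace I (f p) →L[ℝ] TangentSpace J p :=
  sharp gN p ∘L (ContinuousLinearMap.precomp ℝ (mfderiv J I f p)) ∘L g.inner (f p)

lemma inner_tangential (f : N → M) (p : N) (w : TangentSpace I (f p)) (v : TangentSpace J p) :
    gN.inner p (tangential g gN f p w) v = g.inner (f p) w (mfderiv J I f p v) := by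
  simp [tangential]

namespace AlmostContactMetric

variable (S : AlmostContactMetric g)

/-- `f : N → M` is an isometric immersion of an `n`-dimensional manifold into the
`(2n+1)`-dimensional manifold `M`, to which `ξ` is normal. -/
structure IsLegendrian (f : N → M) : Prop where
  smooth : ContMDiff J I ∞ f
  isometric : ∀ (p : N) (u v : TangentSpace J p),
    g.inner (f p) (mfderiv J I f p u) (mfderiv J I f p v) = gN.inner p u v
  dim : Module.finrank ℝ E = 2 * Module.finrank ℝ E' + 1
  normal : ∀ (p : N) (u : TangentSpace J p), g.inner (f p) (S.ξ (f p)) (mfderiv J I f p u) = 0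

/-- `h₁ X` is the tangential component of `h X`. -/
def h₁ (f : N → M) (p : N) : TangentSpace J p →L[ℝ] TangentSpace J p :=
  tangential g gN f p ∘L S.h (f p) ∘L mfderiv J I f p

/-- `h₂ X` is defined by `φ h₂ X = (h X)^⊥`; as `φ² = -1` on vectors orthogonal to `ξ`,
it is (the vector of `T_p N` corresponding to) `-φ((h X)^⊥)`. -/
def h₂ (f : N → M) (p : N) : TangentSpace J p →L[ℝ] TangentSpace J p :=
  -(tangential g gN f p ∘L S.φ (f p) ∘L
    (S.h (f p) ∘L mfderiv J I f p - mfderiv J I f p ∘L S.h₁ gN f p))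

end AlmostContactMetric

end
end ContactGeometry

open ContactGeometry

namespace ContactGeometry

open Filter Topology

noncomputable section

variable {E : Type*} [NormedAddCommGroup E] [NormedSpace ℝ E]
  {H : Type*} [TopologicalSpace H] {I : ModelWithCorners ℝ E H}
  {M : Type*} [TopologicalSpace M] [ChartedSpace H M] [IsManifold I ∞ M]
  {E' : Type*} [NormedAddCommGroup E'] [NormedSpace ℝ E']
  {H' : Type*} [TopologicalSpace H'] {J : ModelWithCorners ℝ E' H'}
  {N : Type*} [TopologicalSpace N] [ChartedSpace H' N] [IsManifold J ∞ N]

/-! ### Smooth vector fields and Lie brackets -/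

section

/-! Call a vector horizontal if η kills it, and put τ = ∇ξ + φ. The heart of the proof is
`inner_nablaEndo_eq_zero`: in a (κ,μ)-space the horizontal parts of ∇φ and ∇τ vanish, and since h =
φτ the same holds for ∇h. Granted this, differentiate hY = h₁Y + φh₂Y along N and insert the Gauss
formula (`covDerivAlong_h_mfderiv`). All of TN and φTN is horizontal, so ∇h and ∇φ drop out of the
TN and φTN components; the first component is the formula for ∇̄h₁, the second the one for ∇̄h₂. The
splitting TM = TN ⊕ φTN ⊕ ℝξ along N holds because dη vanishes on N, by a dimension count. The third
identity comes from differentiating g(Y,ξ) = 0 and needs no curvature.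

For the vanishing: dη = Φ makes τ self-adjoint; L_ξ dη = 0 and the derivative of φ² give τφ = -φτ
and ∇_ξ φ = 0, whence h = φτ. The curvature condition prescribes (∇_u P)v - (∇_v P)u for P = ∇ξ = τ
- φ. Taking v = ξ yields τ² = 1 - κ on horizontal vectors (`τ_τ`). For u, v horizontal it says that
∇τ and ∇φ have the same skew part in u, v. With the derivatives of the algebraic relations this is a
linear system for two trilinear forms, solved in `trilinear_vanish`: ∇φ vanishes in the directions
φτu, which are all horizontal directions when κ ≠ 1. When κ = 1, τ is zero and the system is
immediate.

The connections come from Koszul's formula and the derivative along f from a local frame, so the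
symmetry and normality of σ are derived from torsion-freeness and metric compatibility along f.
These rest on a tensoriality principle: an identity that is function-linear in a field along f need
only be checked on pulled-back frame extensions. -/

lemma SmoothAt.mdiff {X : Π x : M, TangentSpace I x} {x : M} (hX : SmoothAt X x) :
    MDiffAt (T% X) x :=
  ContMDiffAt.mdifferentiableAt hX (by simp)

lemma SmoothAt.eventually_mdiff {X : Π x : M, TangentSpace I x} {x : M} (hX : SmoothAt X x) :
    ∀ᶠ y in 𝓝 x, MDiffAt (T% X) y := by
  -- Order ∞ at a point does not spread to one neighbourhood, whereas order 1 does.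
  have h1 : CMDiffAt 1 (T% X) x := ContMDiffAt.of_le hX (by simp)
  have h2 := (contMDiffAt_iff_contMDiffAt_nhds (by simp)).1 h1
  filter_upwards [h2] with y hy
  exact hy.mdifferentiableAt one_ne_zero

lemma smoothAt_extend {x : M} (v : TangentSpace I x) : SmoothAt (FiberBundle.extend E v) x :=
  FiberBundle.contMDiffAt_extend ..

lemma mvfderiv_congr {F : Type*} [NormedAddCommGroup F] [NormedSpace ℝ F] {f f' : M → F} {x : M}
    (h : f =ᶠ[𝓝 x] f') : d% f x = d% f' x := by
  simp only [mvfderiv]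
  have := h.mfderiv_eq (I := I) (I' := 𝓘(ℝ, F))
  ext u
  simp only [ContinuousLinearMap.comp_apply, this]
  rfl

/-- The differential of a smooth map, applied to a smooth vector field, is smooth. -/
lemma contMDiffAt_mfderiv_apply {f : N → M} {p : N} (hf : ContMDiffAt J I ∞ f p)
    {Y : Π q : N, TangentSpace J q} (hY : SmoothAt Y p) :
    ContMDiffAt J I.tangent ∞
      (fun q ↦ TotalSpace.mk' E (E := fun x : M ↦ TangentSpace I x) (f q) (mfderiv J I f q (Y q))) p :=
  ContMDiffAt.clm_apply_of_inCoordinates (hf.mfderiv_const (by simp)) hY hf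

lemma contMDiffAt_mvfderiv_apply {F : M → ℝ} {x : M} (hF : CMDiffAt ∞ F x)
    {X : Π x : M, TangentSpace I x} (hX : SmoothAt X x) :
    CMDiffAt ∞ (fun y ↦ d% F y (X y)) x := by
  have := contMDiffAt_mfderiv_apply hF hX
  rw [contMDiffAt_totalSpace] at this
  simpa [TangentBundle.trivializationAt_apply] using! this.2

instance : IsManifold I (minSmoothness ℝ 3) M :=
  IsManifold.of_le (n := ∞) (by
    rw [minSmoothness_of_isRCLikeNormedField]
    exact WithTop.coe_le_coe.2 (le_top (a := ((3 : ℕ) : ℕ∞))))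

lemma mlieBracket_smoothAt [CompleteSpace E] {X Y : Π x : M, TangentSpace I x} {x : M}
    (hX : SmoothAt X x) (hY : SmoothAt Y x) : SmoothAt (mlieBracket I X Y) x := by
  have : IsManifold I (((⊤ : ℕ∞) : WithTop ℕ∞) + 1) M := by simpa
  exact ContMDiffAt.mlieBracket_vectorField (m := ⊤) (n := ⊤) hX hY (by simp)

lemma SmoothAt.smul {F : M → ℝ} {X : Π x : M, TangentSpace I x} {x : M} (hF : CMDiffAt ∞ F x)
    (hX : SmoothAt X x) : SmoothAt (F • X) x :=
  ContMDiffAt.smul_section hF hX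

lemma jacobi [CompleteSpace E] {X Y Z : Π x : M, TangentSpace I x} {x : M}
    (hX : SmoothAt X x) (hY : SmoothAt Y x) (hZ : SmoothAt Z x) :
    mlieBracket I X (mlieBracket I Y Z) x =
      mlieBracket I (mlieBracket I X Y) Z x + mlieBracket I Y (mlieBracket I X Z) x := by
  apply leibniz_identity_mlieBracket_apply
  · exact ContMDiffAt.of_le hX (by
    rw [minSmoothness_of_isRCLikeNormedField]
    exact WithTop.coe_le_coe.2 (le_top (a := ((2 : ℕ) : ℕ∞))))
  · exact ContMDiffAt.of_le hY (by
    rw [minSmoothness_of_isRCLikeNormedField]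
    exact WithTop.coe_le_coe.2 (le_top (a := ((2 : ℕ) : ℕ∞))))
  · exact ContMDiffAt.of_le hZ (by
    rw [minSmoothness_of_isRCLikeNormedField]
    exact WithTop.coe_le_coe.2 (le_top (a := ((2 : ℕ) : ℕ∞))))

/-- The Lie bracket of vector fields is the commutator of the corresponding derivations. -/
lemma mvfderiv_mlieBracket [CompleteSpace E] {X Y : Π x : M, TangentSpace I x} {F : M → ℝ} {x : M}
    (hX : SmoothAt X x) (hY : SmoothAt Y x) (hF : CMDiffAt ∞ F x) :
    d% F x (mlieBracket I X Y x) =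
      d% (fun y ↦ d% F y (Y y)) x (X x) - d% (fun y ↦ d% F y (X y)) x (Y x) := by
  -- The argument compares coefficients of a field Z with Z x ≠ 0 in the Jacobi identity for X, Y, F
  -- • Z; such a Z requires E ≠ 0.
  by_cases h0 : ∀ v : E, v = 0
  · have h1 (v : TangentSpace I x) : v = 0 := h0 v
    rw [h1 (mlieBracket I X Y x), h1 (X x), h1 (Y x)]
    simp
  push Not at h0
  obtain ⟨v, hv⟩ := h0
  let Z : Π y : M, TangentSpace I y := FiberBundle.extend E (x := x) (v : TangentSpace I x)
  have hZ : SmoothAt Z x := smoothAt_extend _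
  have hZx : Z x ≠ 0 := by
    rw [show Z x = v from FiberBundle.extend_apply_self ..]
    exact hv
  have key (X Y : Π y : M, TangentSpace I y) (hX : SmoothAt X x) (hY : SmoothAt Y x) :
      mlieBracket I X (mlieBracket I Y (F • Z)) x =
        d% (fun y ↦ d% F y (Y y)) x (X x) • Z x + d% F x (Y x) • mlieBracket I X Z x +
          (d% F x (X x) • mlieBracket I Y Z x + F x • mlieBracket I X (mlieBracket I Y Z) x) := by
    have h1 : mlieBracket I Y (F • Z) =ᶠ[𝓝 x]
        (fun y ↦ d% F y (Y y)) • Z + F • mlieBracket I Y Z := by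
      have h2 : CMDiffAt 1 F x := hF.of_le (by simp)
      filter_upwards [(contMDiffAt_iff_contMDiffAt_nhds (by simp)).1 h2, hZ.eventually_mdiff] with y hy hy'
      rw [mlieBracket_smul_right (hy.mdifferentiableAt one_ne_zero) hy']
      rfl
    have hdF := contMDiffAt_mvfderiv_apply hF hY
    have hYZ := mlieBracket_smoothAt hY hZ
    rw [(EventuallyEq.refl (𝓝 x) X).mlieBracket_vectorField_eq h1,
      mlieBracket_add_right (SmoothAt.smul hdF hZ).mdiff (SmoothAt.smul hF hYZ).mdiff,
      mlieBracket_smul_right (hdF.mdifferentiableAt (by simp)) hZ.mdiff,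
      mlieBracket_smul_right (hF.mdifferentiableAt (by simp)) hYZ.mdiff]
  have j1 := jacobi hX hY (SmoothAt.smul hF hZ)
  rw [key X Y hX hY, key Y X hY hX, mlieBracket_smul_right (hF.mdifferentiableAt (by simp)) hZ.mdiff,
    jacobi hX hY hZ] at j1
  have j2 : (d% F x (mlieBracket I X Y x) - (d% (fun y ↦ d% F y (Y y)) x (X x)
      - d% (fun y ↦ d% F y (X y)) x (Y x))) • Z x = 0 := by
    rw [← sub_eq_zero] at j1
    rw [← neg_eq_zero, ← j1]
    module
  have := (smul_eq_zero.1 j2).resolve_right hZx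
  linarith

end

/-! ### Covariant derivatives of endomorphism fields -/

section

variable [FiniteDimensional ℝ E] {g : Metric I M} {x : M} {X Y Z : Π x : M, TangentSpace I x}
  {A B : Π x : M, TangentSpace I x →L[ℝ] TangentSpace I x}

/-- The field `A` of endomorphisms preserves differentiability of vector fields at `x`. -/
def DiffEndoAt (A : Π x : M, TangentSpace I x →L[ℝ] TangentSpace I x) (x : M) : Prop :=
  ∀ X : Π x : M, TangentSpace I x, MDiffAt (T% X) x → MDiffAt (T% (fun y ↦ A y (X y))) x

lemma DiffEndoAt.comp (hA : DiffEndoAt A x) (hB : DiffEndoAt B x) :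
    DiffEndoAt (fun y ↦ A y ∘L B y) x :=
  fun _ hX ↦ hA _ (hB _ hX)

lemma DiffEndoAt.sub (hA : DiffEndoAt A x) (hB : DiffEndoAt B x) :
    DiffEndoAt (fun y ↦ A y - B y) x :=
  fun _ hX ↦ mdifferentiableAt_sub_section (hA _ hX) (hB _ hX)

lemma leviCivita_add (hY : MDiffAt (T% Y) x) (hZ : MDiffAt (T% Z) x) :
    leviCivita g (fun y ↦ Y y + Z y) x = leviCivita g Y x + leviCivita g Z x :=
  (leviCivita g).isCovariantDerivativeOn.add hY hZ

lemma leviCivita_smul {F : M → ℝ} (hY : MDiffAt (T% Y) x) (hF : MDiffAt F x)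
    (u : TangentSpace I x) :
    leviCivita g (fun y ↦ F y • Y y) x u = F x • leviCivita g Y x u + d% F x u • Y x := by
  have := (leviCivita g).isCovariantDerivativeOnUniv.leibniz hY hF
  exact congrArg (fun L : TangentSpace I x →L[ℝ] TangentSpace I x ↦ L u) this

lemma leviCivita_neg (hY : MDiffAt (T% Y) x) :
    leviCivita g (fun y ↦ -Y y) x = -leviCivita g Y x := by
  have := (leviCivita g).isCovariantDerivativeOnUniv.smul_const (-1) hY
  rw [show (fun y ↦ -Y y) = (-1 : ℝ) • Y by ext; simp]
  simpa using! this

lemma leviCivita_sub (hY : MDiffAt (T% Y) x) (hZ : MDiffAt (T% Z) x) :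
    leviCivita g (fun y ↦ Y y - Z y) x = leviCivita g Y x - leviCivita g Z x := by
  have := leviCivita_add (g := g) hY (mdifferentiableAt_neg_section hZ)
  simp only [Pi.neg_apply, ← sub_eq_add_neg] at this
  rw [this, show -Z = fun y ↦ -Z y from rfl, leviCivita_neg hZ, sub_eq_add_neg]

/-- A tensorial operation on vector fields only depends on the value at `x`. -/
lemma extend_congr {V : Type*} [AddCommGroup V] [Module ℝ V] {Φ : (Π x : M, TangentSpace I x) → V}
    (hΦ : TensorialAt I E Φ x) (hY : MDiffAt (T% Y) x) : Φ (FiberBundle.extend E (Y x)) = Φ Y :=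
  hΦ.pointwise (FiberBundle.mdifferentiableAt_extend ..) hY (by simp)

variable (g A) in
/-- The tensor `(∇_u A) v`. -/
def nablaEndo (x : M) (u v : TangentSpace I x) : TangentSpace I x :=
  leviCivita g (fun y ↦ A y (FiberBundle.extend E v y)) x u
    - A x (leviCivita g (FiberBundle.extend E v) x u)

/-- The two Leibniz terms dF(u) AY cancel. Hence `nablaEndo`, defined with one particular extension
of v, does not depend on it. -/
lemma covDerivEndo_tensorial (hA : DiffEndoAt A x) (u : TangentSpace I x) :
    TensorialAt I E (fun Y ↦ leviCivita g (fun y ↦ A y (Y y)) x u - A x (leviCivita g Y x u)) x where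
  smul {F Y} hF hY := by
    simp only [Pi.smul_apply', map_smul, leviCivita_smul (hA Y hY) hF]
    rw [show F • Y = fun y ↦ F y • Y y from rfl, leviCivita_smul hY hF]
    simp only [map_add, map_smul]
    module
  add {Y Z} hY hZ := by
    simp only [Pi.add_apply, map_add, leviCivita_add (hA Y hY) (hA Z hZ)]
    rw [show Y + Z = fun y ↦ Y y + Z y from rfl, leviCivita_add hY hZ]
    simp only [map_add, add_apply]
    module

lemma nablaEndo_apply (hA : DiffEndoAt A x) (hY : MDiffAt (T% Y) x) (u : TangentSpace I x) :
    nablaEndo g A x u (Y x) =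
      leviCivita g (fun y ↦ A y (Y y)) x u - A x (leviCivita g Y x u) :=
  extend_congr (covDerivEndo_tensorial hA u) hY

lemma mdiff_extend (v : TangentSpace I x) : MDiffAt (T% (FiberBundle.extend E v)) x :=
  FiberBundle.mdifferentiableAt_extend ..

lemma leviCivita_endo (hA : DiffEndoAt A x) (hY : MDiffAt (T% Y) x) (u : TangentSpace I x) :
    leviCivita g (fun y ↦ A y (Y y)) x u =
      nablaEndo g A x u (Y x) + A x (leviCivita g Y x u) := by
  rw [nablaEndo_apply hA hY, sub_add_cancel]

lemma nablaEndo_neg_right (hA : DiffEndoAt A x) (u v : TangentSpace I x) :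
    nablaEndo g A x u (-v) = -nablaEndo g A x u v := by
  have h := mdiff_extend v
  have := nablaEndo_apply (g := g) hA (mdifferentiableAt_neg_section h) u
  simp only [Pi.neg_apply, FiberBundle.extend_apply_self, map_neg] at this
  rw [this, leviCivita_neg (hA _ h), show -FiberBundle.extend E v = fun y ↦ -FiberBundle.extend E v y from rfl,
    leviCivita_neg h, nablaEndo]
  simp only [neg_apply, map_neg]
  module

lemma nablaEndo_smul_left (c : ℝ) (u v : TangentSpace I x) :
    nablaEndo g A x (c • u) v = c • nablaEndo g A x u v := by
  simp [nablaEndo, smul_sub]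

lemma nablaEndo_add (hA : DiffEndoAt A x) (hB : DiffEndoAt B x) (u v : TangentSpace I x) :
    nablaEndo g (fun y ↦ A y + B y) x u v = nablaEndo g A x u v + nablaEndo g B x u v := by
  simp only [nablaEndo, add_apply, leviCivita_add (hA _ (mdiff_extend v)) (hB _ (mdiff_extend v))]
  module

lemma nablaEndo_sub (hA : DiffEndoAt A x) (hB : DiffEndoAt B x) (u v : TangentSpace I x) :
    nablaEndo g (fun y ↦ A y - B y) x u v = nablaEndo g A x u v - nablaEndo g B x u v := by
  simp only [nablaEndo, sub_apply, leviCivita_sub (hA _ (mdiff_extend v)) (hB _ (mdiff_extend v))]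
  module

lemma nablaEndo_zero (u v : TangentSpace I x) : nablaEndo g (fun _ ↦ 0) x u v = 0 := by
  have : leviCivita g (fun y ↦ (0 : TangentSpace I y)) x = 0 := 
    congrFun (CovariantDerivative.zero (leviCivita g)) x
  simp [nablaEndo, this]

lemma nablaEndo_const_smul (hA : DiffEndoAt A x) (c : ℝ) (u v : TangentSpace I x) :
    nablaEndo g (fun y ↦ c • A y) x u v = c • nablaEndo g A x u v := by
  have h := leviCivita_smul (g := g) (F := fun _ ↦ c) (hA _ (mdiff_extend v)) mdifferentiableAt_const u
  simp only [mvfderiv_const, zero_apply, zero_smul, add_zero] at h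
  simp only [nablaEndo, smul_apply, h]
  module

lemma nablaEndo_comp (hA : DiffEndoAt A x) (hB : DiffEndoAt B x) (u v : TangentSpace I x) :
    nablaEndo g (fun y ↦ A y ∘L B y) x u v =
      nablaEndo g A x u (B x v) + A x (nablaEndo g B x u v) := by
  have h1 := leviCivita_endo (g := g) hA (hB _ (mdiff_extend v)) u
  simp only [FiberBundle.extend_apply_self] at h1
  simp only [nablaEndo, ContinuousLinearMap.comp_apply] at h1 ⊢
  rw [h1, map_sub]
  module

/-- The covariant derivative of a self-adjoint or skew-adjoint field of endomorphisms has the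
same symmetry. -/
lemma inner_nablaEndo (hA : DiffEndoAt A x) {c : ℝ}
    (h : ∀ (y : M) (u v : TangentSpace I y), g.inner y (A y u) v = c * g.inner y u (A y v))
    (u v w : TangentSpace I x) :
    g.inner x (nablaEndo g A x u v) w = c * g.inner x v (nablaEndo g A x u w) := by
  have hv := mdiff_extend v
  have hw := mdiff_extend w
  have hu := mdiff_extend u
  have h1 := leviCivita_metric (g := g) hu (hA _ hv) hw
  have h2 := leviCivita_metric (g := g) hu hv (hA _ hw)
  simp only [h] at h1
  have h3 : d% (fun y ↦ c * g.inner y (FiberBundle.extend E v y) (A y (FiberBundle.extend E w y))) x u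
      = c * d% (fun y ↦ g.inner y (FiberBundle.extend E v y) (A y (FiberBundle.extend E w y))) x u := by
    rw [mvfderiv_fun_mul mdifferentiableAt_const (g.mdiff hv (hA _ hw))]
    simp [mvfderiv_const]
  simp only [FiberBundle.extend_apply_self] at h1 h2
  rw [h3, h2] at h1
  simp only [nablaEndo, map_sub, sub_apply, h]
  linarith

end

/-! ### Contact metric structures: ∇ξ, τ and h -/

section

namespace AlmostContactMetric

variable [FiniteDimensional ℝ E] {g : Metric I M} (S : AlmostContactMetric g) {x : M}
  {X Y : Π x : M, TangentSpace I x}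

/-- From φ²ξ = 0 one gets φ²(φξ) = 0, that is φξ = η(φξ)ξ; a further φ gives η(φξ)φξ = 0, and either
factor being zero suffices. -/
lemma φ_ξ : S.φ x (S.ξ x) = 0 := by
  have h1 : S.φ x (S.φ x (S.ξ x)) = 0 := by simp [S.φ_sq, S.η_ξ]
  have h2 := S.φ_sq x (S.φ x (S.ξ x))
  rw [h1, map_zero] at h2
  have h3 : S.φ x (S.ξ x) = S.η x (S.φ x (S.ξ x)) • S.ξ x := by
    rw [eq_comm, add_eq_zero_iff_neg_eq, neg_neg] at h2
    exact h2
  have h4 := congrArg (S.φ x) h3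
  rw [h1, map_smul] at h4
  rcases smul_eq_zero.1 h4.symm with h | h
  · rw [h3, h, zero_smul]
  · exact h

lemma ξ_ne_zero : S.ξ x ≠ 0 := fun h ↦ by simpa [h] using S.η_ξ x

/-- Compare φ²(φv) with φ(φ²v). -/
lemma η_φ (v : TangentSpace I x) : S.η x (S.φ x v) = 0 := by
  have h1 := S.φ_sq x (S.φ x v)
  rw [S.φ_sq x v, map_add, map_smul, S.φ_ξ, smul_zero, add_zero, map_neg] at h1
  have h2 : S.η x (S.φ x v) • S.ξ x = 0 := by simpa using h1.symm
  exact (smul_eq_zero.1 h2).resolve_right S.ξ_ne_zero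

lemma inner_ξ_right (v : TangentSpace I x) : g.inner x v (S.ξ x) = S.η x v := by
  have := S.compat x v (S.ξ x)
  simp only [S.φ_ξ, map_zero, S.η_ξ] at this
  linarith

lemma inner_ξ_left (v : TangentSpace I x) : g.inner x (S.ξ x) v = S.η x v := by
  rw [g.symm, S.inner_ξ_right]

lemma inner_φ_left (u v : TangentSpace I x) :
    g.inner x (S.φ x u) v = -g.inner x u (S.φ x v) := by
  have := S.compat x u (S.φ x v)
  simp only [S.φ_sq, map_add, map_neg, map_smul, S.η_φ, S.inner_ξ_right, smul_eq_mul] at this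
  linarith

lemma φ_φ_of_horizontal {v : TangentSpace I x} (hv : S.η x v = 0) : S.φ x (S.φ x v) = -v := by
  simp [S.φ_sq, hv]

lemma mdiff_η (hX : MDiffAt (T% X) x) : MDiffAt (fun y ↦ S.η y (X y)) x := by
  simp only [← S.inner_ξ_right]
  exact g.mdiff hX ((S.smooth_ξ x).mdifferentiableAt (by simp))

lemma mdiff_ξ : MDiffAt (T% S.ξ) x := (S.smooth_ξ x).mdifferentiableAt (by simp)

lemma smoothAt_ξ : SmoothAt S.ξ x := S.smooth_ξ x

lemma smoothAt_φ (hX : SmoothAt X x) : SmoothAt (fun y ↦ S.φ y (X y)) x :=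
  ContMDiffAt.clm_bundle_apply (F₁ := E) (F₂ := E) (S.smooth_φ x) hX

lemma contMDiffAt_η (hX : SmoothAt X x) : CMDiffAt ∞ (fun y ↦ S.η y (X y)) x := by
  have : ContMDiffAt I (I.prod 𝓘(ℝ)) ∞
      (fun y ↦ TotalSpace.mk' ℝ (E := Bundle.Trivial M ℝ) y (S.η y (X y))) x :=
    ContMDiffAt.clm_bundle_apply (F₁ := E) (F₂ := ℝ) (E₂ := Bundle.Trivial M ℝ) (S.smooth_η x) hX
  rw [contMDiffAt_totalSpace] at this
  exact this.2

lemma diffEndoAt_φ : DiffEndoAt S.φ x := fun _ hX ↦ S.mdiff_φ hX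

lemma mvfderiv_η (hX : MDiffAt (T% X) x) (u : TangentSpace I x) :
    d% (fun y ↦ S.η y (X y)) x u =
      S.η x (leviCivita g X x u) + g.inner x (X x) (leviCivita g S.ξ x u) := by
  simp only [← S.inner_ξ_right]
  have := leviCivita_metric (g := g) (mdiff_extend u) hX S.mdiff_ξ
  simpa using this

lemma η_nabla_ξ (u : TangentSpace I x) : S.η x (leviCivita g S.ξ x u) = 0 := by
  have := S.mvfderiv_η S.mdiff_ξ u
  simp only [S.η_ξ, mvfderiv_const, S.inner_ξ_left, zero_apply] at this
  linarith

/-- The tensor `∇ξ + φ`; on a contact metric manifold, it is equal to `hφ`. -/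
def τ (x : M) : TangentSpace I x →L[ℝ] TangentSpace I x := leviCivita g S.ξ x + S.φ x

lemma nabla_ξ (u : TangentSpace I x) : leviCivita g S.ξ x u = S.τ x u - S.φ x u := by
  simp [τ]

lemma η_τ (u : TangentSpace I x) : S.η x (S.τ x u) = 0 := by
  simp [τ, S.η_nabla_ξ, S.η_φ]

variable {S}

/-- By torsion-freeness the skew part of ∇ξ is dη, which the contact condition identifies with -φ; τ
is the symmetric part that remains. -/
lemma IsContactMetric.inner_τ (hS : S.IsContactMetric) (u v : TangentSpace I x) :
    g.inner x (S.τ x u) v = g.inner x u (S.τ x v) := by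
  have h := hS x _ _ (smoothAt_extend u) (smoothAt_extend v)
  have hu := mdiff_extend u
  have hv := mdiff_extend v
  rw [S.mvfderiv_η hu, S.mvfderiv_η hv, ← leviCivita_torsion (g := g) hu hv] at h
  simp only [FiberBundle.extend_apply_self, map_sub] at h
  have h1 := S.inner_φ_left u v
  simp only [τ, add_apply, map_add]
  rw [g.symm x _ v]
  linarith

lemma IsContactMetric.τ_ξ (hS : S.IsContactMetric) : S.τ x (S.ξ x) = 0 := by
  refine g.ext_inner fun w ↦ ?_
  rw [hS.inner_τ, S.inner_ξ_left, S.η_τ]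
  simp

lemma IsContactMetric.nabla_ξ_ξ (hS : S.IsContactMetric) : leviCivita g S.ξ x (S.ξ x) = 0 := by
  rw [S.nabla_ξ, hS.τ_ξ, S.φ_ξ, sub_zero]

/-- Extends the contact condition from smooth to merely differentiable fields. This is what is
available at the points near x when the identity has to be differentiated. -/
lemma IsContactMetric.contact_form (hS : S.IsContactMetric) (hX : MDiffAt (T% X) x)
    (hY : MDiffAt (T% Y) x) :
    g.inner x (X x) (S.φ x (Y x)) = (1 / 2 : ℝ) * (d% (fun y ↦ S.η y (Y y)) x (X x)
      - d% (fun y ↦ S.η y (X y)) x (Y x) - S.η x (mlieBracket I X Y x)) := by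
  rw [S.mvfderiv_η hX, S.mvfderiv_η hY, ← leviCivita_torsion (g := g) hX hY]
  simp only [S.nabla_ξ, map_sub]
  rw [g.symm x (Y x), g.symm x (Y x), hS.inner_τ, S.inner_φ_left]
  linarith

lemma IsContactMetric.η_mlieBracket_ξ (hS : S.IsContactMetric) (hX : MDiffAt (T% X) x) :
    S.η x (mlieBracket I S.ξ X x) = d% (fun y ↦ S.η y (X y)) x (S.ξ x) := by
  have := hS.contact_form S.mdiff_ξ hX
  simp only [S.η_ξ, mvfderiv_const, S.inner_ξ_left, S.η_φ, zero_apply] at this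
  linarith

/-- `L_ξ dη = 0`. -/
lemma IsContactMetric.mvfderiv_inner_φ (hS : S.IsContactMetric) (hX : SmoothAt X x)
    (hY : SmoothAt Y x) :
    d% (fun y ↦ g.inner y (X y) (S.φ y (Y y))) x (S.ξ x) =
      g.inner x (mlieBracket I S.ξ X x) (S.φ x (Y x)) +
        g.inner x (X x) (S.φ x (mlieBracket I S.ξ Y x)) := by
  have hξX := mlieBracket_smoothAt S.smoothAt_ξ hX
  have hξY := mlieBracket_smoothAt S.smoothAt_ξ hY
  have hXY := mlieBracket_smoothAt hX hY
  have hηX := S.contMDiffAt_η hX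
  have hηY := S.contMDiffAt_η hY
  have e1 := (contMDiffAt_mvfderiv_apply hηY hX).mdifferentiableAt (by simp)
  have e2 := (contMDiffAt_mvfderiv_apply hηX hY).mdifferentiableAt (by simp)
  have e3 := S.mdiff_η hXY.mdiff
  -- Replace Φ by the formula for dη near x and differentiate along ξ. Second derivatives are
  -- exchanged by the commutator formula, η([ξ,Z]) = ξ(η(Z)) follows from dη(ξ,·) = 0, and the
  -- Jacobi identity handles [ξ,[X,Y]].
  have h1 : (fun y ↦ g.inner y (X y) (S.φ y (Y y))) =ᶠ[𝓝 x] fun y ↦ (1 / 2 : ℝ) *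
      (d% (fun y ↦ S.η y (Y y)) y (X y) - d% (fun y ↦ S.η y (X y)) y (Y y)
        - S.η y (mlieBracket I X Y y)) := by
    filter_upwards [hX.eventually_mdiff, hY.eventually_mdiff] with y hy hy'
    exact hS.contact_form hy hy'
  have h2 {Z : Π x : M, TangentSpace I x} (hZ : SmoothAt Z x) :
      (fun y ↦ S.η y (mlieBracket I S.ξ Z y)) =ᶠ[𝓝 x]
        fun y ↦ d% (fun y ↦ S.η y (Z y)) y (S.ξ y) := by
    filter_upwards [hZ.eventually_mdiff] with y hy
    exact hS.η_mlieBracket_ξ hy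
  have e4 : MDiffAt (fun y ↦ d% (fun y ↦ S.η y (Y y)) y (X y)
      - d% (fun y ↦ S.η y (X y)) y (Y y)) x := e1.sub e2
  have e5 : MDiffAt (fun y ↦ d% (fun y ↦ S.η y (Y y)) y (X y)
      - d% (fun y ↦ S.η y (X y)) y (Y y) - S.η y (mlieBracket I X Y y)) x := e4.sub e3
  rw [mvfderiv_congr h1, mvfderiv_fun_mul mdifferentiableAt_const e5,
    mvfderiv_fun_sub e4 e3, mvfderiv_fun_sub e1 e2,
    hS.contact_form hξX.mdiff hY.mdiff, hS.contact_form hX.mdiff hξY.mdiff,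
    mvfderiv_congr (h2 hX), mvfderiv_congr (h2 hY)]
  have c1 := mvfderiv_mlieBracket S.smoothAt_ξ hX hηY
  have c2 := mvfderiv_mlieBracket S.smoothAt_ξ hY hηX
  have c3 := hS.η_mlieBracket_ξ hXY.mdiff
  have c4 := congrArg (S.η x) (jacobi S.smoothAt_ξ hX hY)
  rw [map_add] at c4
  simp only [mvfderiv_const, smul_zero, add_zero, smul_apply, sub_apply, smul_eq_mul]
  linarith

/-- This is L_ξ Φ = 0 with the brackets expanded by torsion-freeness. -/
lemma IsContactMetric.nablaEndo_ξ_φ_eq (hS : S.IsContactMetric) (v : TangentSpace I x) :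
    nablaEndo g S.φ x (S.ξ x) v = -S.τ x (S.φ x v) - S.φ x (S.τ x v) := by
  refine g.ext_inner fun w ↦ ?_
  have hw := mdiff_extend w
  have hv := mdiff_extend v
  have h := hS.mvfderiv_inner_φ (smoothAt_extend w) (smoothAt_extend v)
  rw [leviCivita_metric S.mdiff_ξ hw (S.mdiff_φ hv), leviCivita_endo S.diffEndoAt_φ hv,
    ← leviCivita_torsion (g := g) S.mdiff_ξ hv, ← leviCivita_torsion (g := g) S.mdiff_ξ hw] at h
  simp only [FiberBundle.extend_apply_self, map_sub, map_add, sub_apply, S.nabla_ξ,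
    S.inner_φ_left w, hS.inner_τ w] at h
  have h1 := S.inner_φ_left w (S.φ x v)
  rw [g.symm x _ w]
  simp only [map_sub, map_neg, sub_apply, neg_apply]
  rw [g.symm x _ w, g.symm x _ w]
  linarith

/-- Both sides are the derivative of φ² = -I + η ⊗ ξ. -/
lemma nablaEndo_φ_φ (u v : TangentSpace I x) :
    nablaEndo g S.φ x u (S.φ x v) + S.φ x (nablaEndo g S.φ x u v) =
      g.inner x v (leviCivita g S.ξ x u) • S.ξ x + S.η x v • leviCivita g S.ξ x u := by
  have hv := mdiff_extend v
  rw [← nablaEndo_comp S.diffEndoAt_φ S.diffEndoAt_φ, nablaEndo]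
  simp only [ContinuousLinearMap.comp_apply, S.φ_sq]
  have := leviCivita_add (g := g) (mdifferentiableAt_neg_section hv)
    ((S.mdiff_η hv).smul_section (S.mdiff_ξ (x := x)))
  simp only [Pi.neg_apply, Pi.smul_apply'] at this
  rw [this]
  rw [show -FiberBundle.extend E v = fun y ↦ -FiberBundle.extend E v y from rfl, leviCivita_neg hv,
    add_apply]
  have h2 := leviCivita_smul (g := g) S.mdiff_ξ (S.mdiff_η hv) u
  rw [S.mvfderiv_η hv] at h2
  simp only [FiberBundle.extend_apply_self] at h2
  rw [show ((fun y ↦ S.η y (FiberBundle.extend E v y)) • S.ξ) =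
    fun y ↦ S.η y (FiberBundle.extend E v y) • S.ξ y from rfl, h2]
  simp only [neg_apply]
  module

/-- Since ∇_ξ ξ = 0, differentiating φ² shows that ∇_ξ φ anticommutes with φ. Inserting ∇_ξ φ = -τφ
- φτ gives τ = φτφ; then apply φ. -/
lemma IsContactMetric.τ_φ (hS : S.IsContactMetric) (v : TangentSpace I x) :
    S.τ x (S.φ x v) = -S.φ x (S.τ x v) := by
  have h := S.nablaEndo_φ_φ (S.ξ x) v
  simp only [hS.nabla_ξ_ξ, hS.nablaEndo_ξ_φ_eq, map_sub, map_neg, S.φ_sq, map_add, map_smul, hS.τ_ξ,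
    S.η_τ, smul_zero, zero_smul, map_zero, add_zero] at h
  have h1 : S.τ x v = S.φ x (S.τ x (S.φ x v)) := by
    have h2 : (2 : ℝ) • (S.τ x v - S.φ x (S.τ x (S.φ x v))) = 0 := by rw [← h]; module
    exact sub_eq_zero.1 ((smul_eq_zero.1 h2).resolve_left two_ne_zero)
  conv_rhs => rw [h1, S.φ_φ_of_horizontal (S.η_τ _), neg_neg]

lemma IsContactMetric.nablaEndo_ξ_φ (hS : S.IsContactMetric) (v : TangentSpace I x) :
    nablaEndo g S.φ x (S.ξ x) v = 0 := by
  rw [hS.nablaEndo_ξ_φ_eq, hS.τ_φ]; simp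

/-- With ∇_ξ φ = 0, the bracket formula reduces to 2hv = φ∇_v ξ - ∇_{φv} ξ; the φ² terms cancel and
the two τ terms agree. -/
lemma IsContactMetric.h_eq (hS : S.IsContactMetric) (v : TangentSpace I x) :
    S.h x v = S.φ x (S.τ x v) := by
  have hv := mdiff_extend v
  have h := S.h_apply hv
  rw [← leviCivita_torsion (g := g) S.mdiff_ξ hv, ← leviCivita_torsion (g := g) S.mdiff_ξ
    (S.mdiff_φ hv), leviCivita_endo S.diffEndoAt_φ hv, hS.nablaEndo_ξ_φ] at h
  simp only [FiberBundle.extend_apply_self, S.nabla_ξ, map_sub, hS.τ_φ] at h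
  rw [h]
  module

lemma IsContactMetric.τ_eq (hS : S.IsContactMetric) (v : TangentSpace I x) :
    S.τ x v = S.h x (S.φ x v) := by
  rw [hS.h_eq, hS.τ_φ, map_neg, S.φ_φ_of_horizontal (S.η_τ _), neg_neg]

lemma IsContactMetric.φ_h (hS : S.IsContactMetric) (v : TangentSpace I x) :
    S.φ x (S.h x v) = -S.τ x v := by
  rw [hS.h_eq, S.φ_φ_of_horizontal (S.η_τ _)]

lemma IsContactMetric.h_φ (hS : S.IsContactMetric) (v : TangentSpace I x) :
    S.h x (S.φ x v) = -S.φ x (S.h x v) := by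
  rw [hS.φ_h, hS.τ_eq, neg_neg]

lemma IsContactMetric.inner_h (hS : S.IsContactMetric) (u v : TangentSpace I x) :
    g.inner x (S.h x u) v = g.inner x u (S.h x v) := by
  rw [hS.h_eq, hS.h_eq, S.inner_φ_left, hS.inner_τ, hS.τ_φ]; simp

lemma IsContactMetric.h_ξ (hS : S.IsContactMetric) : S.h x (S.ξ x) = 0 := by
  rw [hS.h_eq, hS.τ_ξ, map_zero]

lemma IsContactMetric.η_h (hS : S.IsContactMetric) (v : TangentSpace I x) :
    S.η x (S.h x v) = 0 := by
  rw [hS.h_eq, S.η_φ]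

end AlmostContactMetric

end

/-! ### (κ,μ)-spaces: the horizontal parts of ∇φ, ∇τ and ∇h vanish -/

section

/-- To be applied with A(x,y,z) = g((∇_x φ)y, z), C(x,y,z) = g((∇_x τ)y, z) and k = τ on horizontal
vectors. The hypotheses are exactly the instances of linearity and differentiated relations needed,
so V carries no structure. -/
lemma trilinear_vanish {V : Type*} {A C : V → V → V → ℝ} {φ k : V → V}
    (skew : ∀ x y z, A x z y = -A x y z)
    (Aφ : ∀ x y z, A x y (φ z) = A x (φ y) z)
    (φφ₂ : ∀ x y z, A x (φ (φ y)) z = -A x y z)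
    (kφ : ∀ x y z, A x y (k (φ z)) = -A x y (φ (k z)))
    (symm : ∀ x y z, C x z y = C x y z)
    (Cφ : ∀ x y z, C x y (φ (φ z)) = -C x y z)
    (anti : ∀ x y z, A x (k y) z - C x y (φ z) + C x (φ y) z + A x y (k z) = 0)
    (curv : ∀ x y z, -A x y z + A y x z + C x y z - C y x z = 0) (x y z : V) :
    A (φ (k x)) y z = 0 := by
  have cyc (x y z) : A x y z + A y z x + A z x y = 0 := by
    linarith [curv x y z, curv y z x, curv z x y, skew x y z, skew y z x, skew z x y,
      symm x y z, symm y z x, symm z x y]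
  have A_eq (x y z) : A z x y = C y x z - C x y z := by
    linarith [curv x y z, cyc x y z, skew y z x]
  -- The argument that an almost Kähler structure is quasi-Kähler: combine `cyc` for the triples
  -- obtained by applying φ to none or to two of the arguments.
  have quasi (x y z) : A (φ x) (φ y) z = -A x y z := by
    linarith [cyc x y z, cyc (φ x) (φ y) z, cyc (φ x) y (φ z), cyc x (φ y) (φ z), Aφ (φ x) y z,
      Aφ y z x, Aφ (φ y) z x, Aφ z x y, Aφ (φ z) x y, φφ₂ x y z, Aφ x (φ y) z, φφ₂ y z x, Aφ y (φ z) x,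
      φφ₂ z x y, Aφ z (φ x) y]
  have quasi' (x y z) : A (φ x) y z = A x (φ y) z := by
    linarith [quasi x (φ y) z, φφ₂ (φ x) y z]
  have e1 (x y z) : A x (φ y) (φ z) = -A x y z := by rw [Aφ, φφ₂]
  have q (y z x) : C y z x + C y (φ z) (φ x) = -A y (k z) (φ x) + A y (φ z) (k x) := by
    linarith [anti y z (φ x), Cφ y z x, kφ y z x, Aφ y z (k x)]
  have q' (y z x) : C (φ y) (φ z) x - C (φ y) z (φ x) = -A (φ y) (k z) x - A (φ y) z (k x) := by
    linarith [anti (φ y) z x]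
  -- The four instances of `A_eq` are chosen so that the C terms occur only in the combinations `q`
  -- and `q'`, where `anti` turns them into A terms. The outcome is a symmetry in y and z, which
  -- `cyc` converts into the claim.
  have main (x y z) : A y (φ z) (k x) = A z (φ y) (k x) := by
    linarith [A_eq y z x, A_eq (φ y) (φ z) x, A_eq y (φ z) (φ x), A_eq (φ y) z (φ x), e1 x y z,
      quasi x y z, Aφ (φ x) y z, q y z x, q z y x, q' y z x, q' z y x, quasi' y (k z) x,
      quasi' y z (k x), quasi' z (k y) x, quasi' z y (k x), Aφ y (k z) x, Aφ z (k y) x]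
  linarith [main x y z, cyc (φ (k x)) y z, Aφ y z (k x), Aφ z y (k x), skew z y (φ (k x)),
    skew y z (φ (k x))]

section SmoothEndo

variable [FiniteDimensional ℝ E] {x : M}
  {A : Π x : M, TangentSpace I x →L[ℝ] TangentSpace I x}

/-- A field of endomorphisms that maps smooth vector fields to smooth vector fields is smooth. -/
lemma contMDiffAt_endo (hA : ∀ X : Π x : M, TangentSpace I x, SmoothAt X x →
    SmoothAt (fun y ↦ A y (X y)) x) :
    ContMDiffAt I (I.prod 𝓘(ℝ, E →L[ℝ] E)) ∞ (fun x ↦ TotalSpace.mk' (E →L[ℝ] E)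
      (E := fun x : M ↦ TangentSpace I x →L[ℝ] TangentSpace I x) x (A x)) x := by
  rw [contMDiffAt_hom_bundle]
  refine ⟨contMDiffAt_id, ?_⟩
  let b := Module.finBasis ℝ E
  let L (y : M) : E →L[ℝ] E := ContinuousLinearMap.inCoordinates E (TangentSpace I) E
    (TangentSpace I) x y x y (A y)
  have hL (w : E) : CMDiffAt ∞ (fun y ↦ L y w) x := by
    let t := trivializationAt E (fun x : M ↦ TangentSpace I x) x
    let v : TangentSpace I x := t.symm x w
    have h1 := hA _ (smoothAt_extend v)
    rw [SmoothAt, contMDiffAt_section] at h1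
    refine h1.congr_of_eventuallyEq ?_
    have hx : x ∈ t.baseSet := FiberBundle.mem_baseSet_trivializationAt' x
    filter_upwards [t.open_baseSet.mem_nhds hx] with y hy
    have : FiberBundle.extend E v y = t.symm y w := by
      simp [FiberBundle.extend, v, t, t.apply_mk_symm hx]
    rw [this]
    simp only [L, ContinuousLinearMap.inCoordinates, ContinuousLinearMap.comp_apply]
    rw [Trivialization.continuousLinearMapAt_apply, Trivialization.coe_linearMapAt_of_mem _ hy,
      Trivialization.symmL_apply]
    exact hy
  -- The coordinate operator is rebuilt from its finitely many columns L y (b i), each smooth by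
  -- `hL`.
  have h2 : L = fun y ↦ ∑ i, (ContinuousLinearMap.smulRightL ℝ E E
      (LinearMap.toContinuousLinearMap (b.coord i))) (L y (b i)) := by
    ext y w
    simp only [sum_apply, ContinuousLinearMap.smulRightL_apply_apply]
    conv_lhs => rw [← b.sum_repr w, map_sum]
    simp
  change CMDiffAt ∞ L x
  rw [h2]
  refine contMDiffAt_finsetSum fun i _ ↦ ?_
  exact ((ContinuousLinearMap.smulRightL ℝ E E
      (LinearMap.toContinuousLinearMap (b.coord i))).contMDiff.contMDiffAt).comp x (hL (b i))

/-- Testing on smooth fields says nothing directly about differentiable ones; smoothness as a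
section of the Hom bundle bridges the gap. -/
lemma diffEndoAt_of_smooth (hA : ∀ X : Π x : M, TangentSpace I x, SmoothAt X x →
    SmoothAt (fun y ↦ A y (X y)) x) : DiffEndoAt A x :=
  fun _ hX ↦ MDifferentiableAt.clm_bundle_apply (F₁ := E) (F₂ := E)
    ((contMDiffAt_endo hA).mdifferentiableAt (by simp)) hX

end SmoothEndo

namespace AlmostContactMetric

variable [FiniteDimensional ℝ E] {g : Metric I M} {S : AlmostContactMetric g} {x : M}
  {X Y : Π x : M, TangentSpace I x} {κ μ : ℝ}

lemma smoothAt_h (hX : SmoothAt X x) : SmoothAt (fun y ↦ S.h y (X y)) x := by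
  have h1 := mlieBracket_smoothAt S.smoothAt_ξ hX
  have h2 : SmoothAt ((fun _ : M ↦ (1 / 2 : ℝ)) • (mlieBracket I S.ξ (fun y ↦ S.φ y (X y)) -
      fun y ↦ S.φ y (mlieBracket I S.ξ X y))) x :=
    SmoothAt.smul contMDiffAt_const (ContMDiffAt.sub_section
      (mlieBracket_smoothAt S.smoothAt_ξ (S.smoothAt_φ hX)) (S.smoothAt_φ h1))
  refine ContMDiffAt.congr_of_eventuallyEq h2 ?_
  filter_upwards [hX.eventually_mdiff] with y hy
  rw [S.h_apply hy]
  rfl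

lemma diffEndoAt_h : DiffEndoAt S.h x := diffEndoAt_of_smooth fun _ ↦ smoothAt_h

lemma IsContactMetric.diffEndoAt_τ (hS : S.IsContactMetric) : DiffEndoAt S.τ x := by
  have : S.τ = fun y ↦ S.h y ∘L S.φ y := by
    ext y v
    exact hS.τ_eq v
  rw [this]
  exact diffEndoAt_h.comp S.diffEndoAt_φ

lemma IsContactMetric.nablaEndo_nabla_ξ (hS : S.IsContactMetric) (u v : TangentSpace I x) :
    nablaEndo g (leviCivita g S.ξ) x u v = nablaEndo g S.τ x u v - nablaEndo g S.φ x u v := by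
  rw [← nablaEndo_sub hS.diffEndoAt_τ S.diffEndoAt_φ]
  congr 1
  ext y v
  exact S.nabla_ξ v

/-- The derivative of τφ + φτ = 0. -/
lemma IsContactMetric.nablaEndo_τ_φ (hS : S.IsContactMetric) (u v : TangentSpace I x) :
    nablaEndo g S.τ x u (S.φ x v) + S.τ x (nablaEndo g S.φ x u v) +
      (nablaEndo g S.φ x u (S.τ x v) + S.φ x (nablaEndo g S.τ x u v)) = 0 := by
  have hτ : DiffEndoAt S.τ x := hS.diffEndoAt_τ
  rw [← nablaEndo_comp hτ S.diffEndoAt_φ, ← nablaEndo_comp S.diffEndoAt_φ hτ,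
    ← nablaEndo_add (hτ.comp S.diffEndoAt_φ) (S.diffEndoAt_φ.comp hτ), ← nablaEndo_zero u v]
  congr 1
  ext y w
  simp [hS.τ_φ]

lemma IsContactMetric.h_eq_comp (hS : S.IsContactMetric) : S.h = fun y ↦ S.φ y ∘L S.τ y := by
  ext y v
  exact hS.h_eq v

namespace IsKappaMuSpace

/-- By torsion-freeness R(u,v)ξ = (∇_u P)v - (∇_v P)u with P = ∇ξ = τ - φ. -/
lemma nablaEndo_curvature (hS : S.IsKappaMuSpace κ μ) (u v : TangentSpace I x) :
    (nablaEndo g S.τ x u v - nablaEndo g S.φ x u v) -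
      (nablaEndo g S.τ x v u - nablaEndo g S.φ x v u) =
      κ • (S.η x v • u - S.η x u • v) + μ • (S.η x v • S.h x u - S.η x u • S.h x v) := by
  have hu := mdiff_extend u
  have hv := mdiff_extend v
  have h := hS.curvature_ξ x _ _ (smoothAt_extend u) (smoothAt_extend v)
  have hP : DiffEndoAt (leviCivita g S.ξ) x := by
    have := (hS.contact.diffEndoAt_τ (x := x)).sub S.diffEndoAt_φ
    simpa only [← S.nabla_ξ, DiffEndoAt, sub_apply] using this
  rw [curvature, leviCivita_endo hP hu, leviCivita_endo hP hv,
    ← leviCivita_torsion (g := g) hu hv] at h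
  simp only [FiberBundle.extend_apply_self, hS.contact.nablaEndo_nabla_ξ] at h
  rw [← h, map_sub]
  module

/-- The condition on R(u,ξ)ξ reads κu + μhu = u - τ²u - (∇_ξ τ)u. Replace u by φu and apply φ: since
h and ∇_ξ τ anticommute with φ while τ² commutes, the μ and ∇_ξ τ terms return unchanged and the
others change sign. Subtraction isolates τ². -/
lemma τ_τ (hS : S.IsKappaMuSpace κ μ) {u : TangentSpace I x} (hu : S.η x u = 0) :
    S.τ x (S.τ x u) = (1 - κ) • u := by
  have hC := hS.contact
  have key (u : TangentSpace I x) (hu : S.η x u = 0) :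
      κ • u + μ • S.h x u = u - S.τ x (S.τ x u) - nablaEndo g S.τ x (S.ξ x) u := by
    have h := hS.nablaEndo_curvature u (S.ξ x)
    have hτ := nablaEndo_apply (g := g) (hC.diffEndoAt_τ) (S.mdiff_ξ (x := x)) u
    have hφ := nablaEndo_apply (g := g) S.diffEndoAt_φ (S.mdiff_ξ (x := x)) u
    simp only [hC.τ_ξ, S.φ_ξ] at hτ hφ
    rw [hτ, hφ, hC.nablaEndo_ξ_φ] at h
    simp only [S.nabla_ξ, map_sub, hu, S.η_ξ, hC.τ_φ, S.φ_φ_of_horizontal hu] at h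
    rw [zero_smul, zero_smul, one_smul, one_smul, sub_zero, sub_zero, sub_zero] at h
    rw [← h]
    module
  have h1 := key u hu
  have h2 := congrArg (S.φ x) (key (S.φ x u) (S.η_φ u))
  have h3 := hC.nablaEndo_τ_φ (S.ξ x) (S.φ x u)
  rw [hC.nablaEndo_ξ_φ, hC.nablaEndo_ξ_φ, S.φ_φ_of_horizontal hu,
    nablaEndo_neg_right hC.diffEndoAt_τ, map_zero, add_zero, zero_add] at h3
  have h3' := neg_add_eq_zero.1 h3
  simp only [map_sub, map_add, map_smul, hC.h_φ, hC.τ_φ, map_neg, ← h3', S.φ_φ_of_horizontal hu,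
    S.φ_φ_of_horizontal (hC.η_h _), S.φ_φ_of_horizontal (S.η_τ _), neg_neg] at h2
  have h4 : (2 : ℝ) • (S.τ x (S.τ x u) - (1 - κ) • u) = 0 := by
    rw [← sub_eq_zero] at h1 h2
    have : (0 : TangentSpace I x) = 0 - 0 := by simp
    rw [this]
    nth_rw 1 [← h1]
    rw [← h2]
    module
  exact sub_eq_zero.1 ((smul_eq_zero.1 h4).resolve_left two_ne_zero)

lemma inner_nablaEndo_eq_zero (hS : S.IsKappaMuSpace κ μ) {u v w : TangentSpace I x}
    (hu : S.η x u = 0) (hv : S.η x v = 0) (hw : S.η x w = 0) :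
    g.inner x (nablaEndo g S.φ x u v) w = 0 ∧ g.inner x (nablaEndo g S.τ x u v) w = 0 := by
  have hC := hS.contact
  have dφ : DiffEndoAt S.φ x := S.diffEndoAt_φ
  have dτ : DiffEndoAt S.τ x := hC.diffEndoAt_τ
  have skew (u v w : TangentSpace I x) : g.inner x (nablaEndo g S.φ x u w) v =
      -g.inner x (nablaEndo g S.φ x u v) w := by
    rw [inner_nablaEndo dφ (c := -1) (fun y u v ↦ by rw [S.inner_φ_left]; ring), g.symm]
    ring
  have symm (u v w : TangentSpace I x) : g.inner x (nablaEndo g S.τ x u w) v =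
      g.inner x (nablaEndo g S.τ x u v) w := by
    rw [inner_nablaEndo dτ (c := 1) (fun y u v ↦ by rw [hC.inner_τ]; ring), g.symm, one_mul]
  have curv {u v w : TangentSpace I x} (hu : S.η x u = 0) (hv : S.η x v = 0) :
      -g.inner x (nablaEndo g S.φ x u v) w + g.inner x (nablaEndo g S.φ x v u) w
      + g.inner x (nablaEndo g S.τ x u v) w - g.inner x (nablaEndo g S.τ x v u) w = 0 := by
    have := congrArg (fun a ↦ g.inner x a w) (hS.nablaEndo_curvature u v)
    simp only [hu, hv, zero_smul, sub_zero, smul_zero, add_zero, map_sub, map_zero,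
      sub_apply, zero_apply] at this
    linarith
  by_cases hκ : κ = 1
  -- Here |τv|² = g(v, τ²v) = 0 for v horizontal, and τξ = 0.
  · have τ0 : S.τ = fun _ ↦ 0 := by
      ext y v
      have h0 (v : TangentSpace I y) (hv : S.η y v = 0) : S.τ y v = 0 := by
        by_contra hne
        have h1 := g.pos y _ hne
        rw [hC.inner_τ, hS.τ_τ hv, hκ] at h1
        simp at h1
      have h2 := h0 (v - S.η y v • S.ξ y) (by simp [S.η_ξ])
      rw [map_sub, map_smul, hC.τ_ξ, smul_zero, sub_zero] at h2
      exact h2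
    rw [τ0] at curv ⊢
    simp only [nablaEndo_zero, map_zero, zero_apply, add_zero, sub_zero, and_true] at curv ⊢
    -- A form symmetric in its first two slots and skew in the last two is zero.
    linarith [curv (w := w) hu hv, curv (w := u) hv hw, curv (w := v) hw hu, skew u v w, skew v w u,
      skew w u v]
  · let V := {v : TangentSpace I x // S.η x v = 0}
    let φ' (v : V) : V := ⟨S.φ x v, S.η_φ _⟩
    let τ' (v : V) : V := ⟨S.τ x v, S.η_τ _⟩
    let A (u v w : V) : ℝ := g.inner x (nablaEndo g S.φ x u v) w
    let C (u v w : V) : ℝ := g.inner x (nablaEndo g S.τ x u v) w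
    have hA (u v w : V) : A (φ' (τ' u)) v w = 0 := by
      refine trilinear_vanish (A := A) (C := C) (φ := φ') (k := τ') (fun u v w ↦ skew u v w)
        (fun u v w ↦ ?_) (fun u v w ↦ ?_) (fun u v w ↦ ?_) (fun u v w ↦ symm u v w)
        (fun u v w ↦ ?_) (fun u v w ↦ ?_) (fun u v w ↦ curv u.2 v.2) u v w
      · have := congrArg (fun a ↦ g.inner x a w) (S.nablaEndo_φ_φ (u : TangentSpace I x) v)
        simp only [map_add, add_apply, S.inner_φ_left, map_smul, smul_apply, S.inner_ξ_left, w.2,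
          v.2, zero_smul, smul_zero, add_zero] at this
        simp only [A, φ']
        linarith
      · simp only [A, φ', S.φ_φ_of_horizontal v.2, nablaEndo_neg_right dφ, map_neg, neg_apply]
      · simp only [A, φ', τ', hC.τ_φ, map_neg]
      · simp only [C, φ', S.φ_φ_of_horizontal w.2, map_neg]
      · have := congrArg (fun a ↦ g.inner x a w) (hC.nablaEndo_τ_φ (u : TangentSpace I x) v)
        simp only [map_add, add_apply, S.inner_φ_left, hC.inner_τ, map_zero, zero_apply] at this
        simp only [A, C, φ', τ']
        linarith
    -- Every horizontal direction is reached: φτ(τφu) = -(1 - κ)u.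
    have hA' (u v w : V) : A u v w = 0 := by
      have h1 : S.φ x (S.τ x (S.τ x (S.φ x (u : TangentSpace I x)))) = (-(1 - κ)) • (u : TangentSpace I x) := by
        rw [hS.τ_τ (S.η_φ _), map_smul, S.φ_φ_of_horizontal u.2, smul_neg, neg_smul]
      have h2 := hA (τ' (φ' u)) v w
      simp only [A, φ', τ', h1, nablaEndo_smul_left, map_smul, smul_apply, smul_eq_mul] at h2
      exact (mul_eq_zero.1 h2).resolve_left (by intro h; exact hκ (by linarith))
    refine ⟨hA' ⟨u, hu⟩ ⟨v, hv⟩ ⟨w, hw⟩, ?_⟩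
    have hC₁ (u v w : V) : C u v w = C v u w := by
      have := curv (w := (w : TangentSpace I x)) u.2 v.2
      have h1 : g.inner x (nablaEndo g S.φ x u v) w = 0 := hA' u v w
      have h2 : g.inner x (nablaEndo g S.φ x v u) w = 0 := hA' v u w
      simp only [C]
      linarith
    -- Differentiate τ² = -(1 - κ)φ², an identity of tensor fields valid on ξ as well. The
    -- derivative of φ² has no purely horizontal part.
    have hC₂ (u v w : V) : C u (τ' v) w + C u v (τ' w) = 0 := by
      have h2 : (fun y ↦ S.τ y ∘L S.τ y) = fun y ↦ (-(1 - κ)) • (S.φ y ∘L S.φ y) := by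
        ext y v
        have h2 := hS.τ_τ (u := v - S.η y v • S.ξ y) (by simp [S.η_ξ])
        rw [map_sub, map_smul, hC.τ_ξ, smul_zero, sub_zero] at h2
        simp only [ContinuousLinearMap.comp_apply, h2, smul_apply, S.φ_sq]
        module
      have h3 := nablaEndo_comp (g := g) dτ dτ u v
      rw [h2, nablaEndo_const_smul (dφ.comp dφ), nablaEndo_comp dφ dφ, S.nablaEndo_φ_φ] at h3
      have h4 := congrArg (fun a ↦ g.inner x a w) h3
      simp only [map_add, add_apply, map_smul, smul_apply, S.inner_ξ_left, w.2, v.2, hC.inner_τ,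
        zero_smul, smul_zero, add_zero] at h4
      exact h4.symm
    -- C is now totally symmetric, so by `hC₂` moving τ between any two slots changes the sign;
    -- going round the three slots gives C = -C.
    have hC₃ (u v w : V) : C (τ' u) v w = 0 := by
      have symm' (u v w : V) : C u w v = C u v w := symm u v w
      linarith [hC₁ (τ' u) v w, hC₂ v u w, hC₁ u v (τ' w), hC₂ u v w, symm' u (τ' v) w,
        hC₁ u w (τ' v), hC₂ w u v, symm' w (τ' u) v, hC₁ w v (τ' u), symm' v w (τ' u)]
    have h1 := hC₃ (τ' ⟨u, hu⟩) ⟨v, hv⟩ ⟨w, hw⟩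
    simp only [C, τ', hS.τ_τ hu, nablaEndo_smul_left, map_smul, smul_apply, smul_eq_mul] at h1
    exact (mul_eq_zero.1 h1).resolve_left (by intro h; exact hκ (by linarith))

lemma inner_nablaEndo_h_eq_zero (hS : S.IsKappaMuSpace κ μ) {u v w : TangentSpace I x}
    (hu : S.η x u = 0) (hv : S.η x v = 0) (hw : S.η x w = 0) :
    g.inner x (nablaEndo g S.h x u v) w = 0 := by
  rw [hS.contact.h_eq_comp, nablaEndo_comp S.diffEndoAt_φ hS.contact.diffEndoAt_τ, map_add,
    add_apply, S.inner_φ_left, (hS.inner_nablaEndo_eq_zero hu (S.η_τ v) hw).1,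
    (hS.inner_nablaEndo_eq_zero hu hv (S.η_φ w)).2]
  simp

end IsKappaMuSpace
end AlmostContactMetric

end

/-! ### Vector fields along a map and tensoriality -/

section

section Along

variable {f : N → M} {p : N} {V W : Π q : N, TangentSpace I (f q)}

variable (J) in
/-- The vector field `V` along `f` is differentiable at `p`. -/
def AlongDiffAt (f : N → M) (V : Π q : N, TangentSpace I (f q)) (p : N) : Prop :=
  MDifferentiableAt J I.tangent (fun q ↦ TotalSpace.mk' E (E := fun x : M ↦ TangentSpace I x) (f q) (V q)) p

/-- The coordinates of a vector field along `f` in the trivialization at `f p`. -/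
def alongCoord (f : N → M) (V : Π q : N, TangentSpace I (f q)) (p q : N) : E :=
  (trivializationAt E (fun x : M ↦ TangentSpace I x) (f p) (TotalSpace.mk' E (f q) (V q))).2

lemma alongDiffAt_iff : AlongDiffAt J f V p ↔
    MDifferentiableAt J I f p ∧ MDifferentiableAt J 𝓘(ℝ, E) (alongCoord f V p) p :=
  mdifferentiableAt_totalSpace ..

lemma alongCoord_add (hf : ContinuousAt f p) :
    alongCoord f (fun q ↦ V q + W q) p =ᶠ[𝓝 p] fun q ↦ alongCoord f V p q + alongCoord f W p q := by
  let t := trivializationAt E (fun x : M ↦ TangentSpace I x) (f p)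
  have hp : f p ∈ t.baseSet := FiberBundle.mem_baseSet_trivializationAt' (f p)
  filter_upwards [hf (t.open_baseSet.mem_nhds hp)] with q hq
  exact (t.linear ℝ hq).1 (V q) (W q)

lemma alongCoord_smul (hf : ContinuousAt f p) (F : N → ℝ) :
    alongCoord f (fun q ↦ F q • V q) p =ᶠ[𝓝 p] fun q ↦ F q • alongCoord f V p q := by
  let t := trivializationAt E (fun x : M ↦ TangentSpace I x) (f p)
  have hp : f p ∈ t.baseSet := FiberBundle.mem_baseSet_trivializationAt' (f p)
  filter_upwards [hf (t.open_baseSet.mem_nhds hp)] with q hq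
  exact (t.linear ℝ hq).2 (F q) (V q)

lemma AlongDiffAt.add (hV : AlongDiffAt J f V p) (hW : AlongDiffAt J f W p) :
    AlongDiffAt J f (fun q ↦ V q + W q) p := by
  rw [alongDiffAt_iff] at hV hW ⊢
  exact ⟨hV.1, (hV.2.add hW.2).congr_of_eventuallyEq (alongCoord_add hV.1.continuousAt)⟩

lemma AlongDiffAt.smul {F : N → ℝ} (hF : MDifferentiableAt J 𝓘(ℝ) F p) (hV : AlongDiffAt J f V p) :
    AlongDiffAt J f (fun q ↦ F q • V q) p := by
  rw [alongDiffAt_iff] at hV ⊢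
  exact ⟨hV.1, (hF.smul hV.2).congr_of_eventuallyEq (alongCoord_smul hV.1.continuousAt F)⟩

lemma AlongDiffAt.mdiff (hV : AlongDiffAt J f V p) : MDifferentiableAt J I f p :=
  (alongDiffAt_iff.1 hV).1

lemma alongDiffAt_zero (hf : MDifferentiableAt J I f p) :
    AlongDiffAt (I := I) J f (fun _ ↦ 0) p := by
  rw [alongDiffAt_iff]
  refine ⟨hf, (mdifferentiableAt_const (c := (0 : E))).congr_of_eventuallyEq ?_⟩
  have := alongCoord_smul (I := I) (V := fun _ ↦ 0) hf.continuousAt (fun _ ↦ (0 : ℝ))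
  simpa using this

lemma AlongDiffAt.sum {ι : Type*} {V : ι → Π q : N, TangentSpace I (f q)} (s : Finset ι)
    (hf : MDifferentiableAt J I f p) (hV : ∀ i, AlongDiffAt J f (V i) p) :
    AlongDiffAt J f (fun q ↦ ∑ i ∈ s, V i q) p := by
  classical
  induction s using Finset.induction_on with
  | empty => simpa using alongDiffAt_zero hf
  | insert a s ha h =>
    simp only [Finset.sum_insert ha]
    exact (hV a).add h

lemma alongDiffAt_comp {Z : Π x : M, TangentSpace I x} (hf : MDifferentiableAt J I f p)
    (hZ : MDiffAt (T% Z) (f p)) : AlongDiffAt J f (fun q ↦ Z (f q)) p :=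
  MDifferentiableAt.comp p hZ hf

/-- An operation on vector fields along `f` that is linear over functions. -/
structure TensorialAlong {A : Type*} [AddCommGroup A] [Module ℝ A] (J : ModelWithCorners ℝ E' H')
    (f : N → M) (p : N) (Φ : (Π q : N, TangentSpace I (f q)) → A) : Prop where
  smul : ∀ {F : N → ℝ} {V : Π q : N, TangentSpace I (f q)}, MDifferentiableAt J 𝓘(ℝ) F p →
    AlongDiffAt J f V p → Φ (fun q ↦ F q • V q) = F p • Φ V
  add : ∀ {V W : Π q : N, TangentSpace I (f q)}, AlongDiffAt J f V p → AlongDiffAt J f W p →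
    Φ (fun q ↦ V q + W q) = Φ V + Φ W

namespace TensorialAlong

variable {A : Type*} [AddCommGroup A] [Module ℝ A] {Φ : (Π q : N, TangentSpace I (f q)) → A}

lemma congr (hΦ : TensorialAlong J f p Φ) (hV : AlongDiffAt J f V p) (hW : AlongDiffAt J f W p)
    (h : ∀ᶠ q in 𝓝 p, V q = W q) : Φ V = Φ W := by
  classical
  -- The indicator of {V = W} is constant near p, hence differentiable there, and ψV = ψW
  -- everywhere; no bump function is needed.
  let ψ (q : N) : ℝ := if V q = W q then 1 else 0
  have hψ : MDifferentiableAt J 𝓘(ℝ) ψ p :=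
    (mdifferentiableAt_const (c := (1 : ℝ))).congr_of_eventuallyEq (h.mono fun q hq ↦ by simp [ψ, hq])
  have h1 : ψ p = 1 := by simp [ψ, h.self_of_nhds]
  have h2 : (fun q ↦ ψ q • V q) = fun q ↦ ψ q • W q := by
    ext q
    by_cases hq : V q = W q <;> simp [ψ, hq]
  have h3 := hΦ.smul hψ hV
  rw [h2, hΦ.smul hψ hW, h1, one_smul, one_smul] at h3
  exact h3.symm

lemma zero (hΦ : TensorialAlong J f p Φ) (hf : MDifferentiableAt J I f p) :
    Φ (fun _ ↦ 0) = 0 := by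
  have := hΦ.smul (F := fun _ ↦ 0) mdifferentiableAt_const (alongDiffAt_zero (I := I) hf)
  simpa using this

lemma sum (hΦ : TensorialAlong J f p Φ) {ι : Type*} {V : ι → Π q : N, TangentSpace I (f q)}
    (s : Finset ι) (hf : MDifferentiableAt J I f p) (hV : ∀ i, AlongDiffAt J f (V i) p) :
    Φ (fun q ↦ ∑ i ∈ s, V i q) = ∑ i ∈ s, Φ (V i) := by
  classical
  induction s using Finset.induction_on with
  | empty => simpa using hΦ.zero hf
  | insert a s ha h =>
    simp only [Finset.sum_insert ha]
    rw [hΦ.add (hV a) (.sum s hf hV), h]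

lemma pointwise [FiniteDimensional ℝ E] (hΦ : TensorialAlong J f p Φ) (hV : AlongDiffAt J f V p)
    (hW : AlongDiffAt J f W p) (h : V p = W p) : Φ V = Φ W := by
  have hf := hV.mdiff
  let t := trivializationAt E (fun x : M ↦ TangentSpace I x) (f p)
  have hp : f p ∈ t.baseSet := FiberBundle.mem_baseSet_trivializationAt' (f p)
  let b := Module.finBasis ℝ E
  let e (i) (q : N) : TangentSpace I (f q) := t.localFrame b i (f q)
  have he (i) : AlongDiffAt J f (e i) p :=
    alongDiffAt_comp hf ((contMDiffAt_localFrame_of_mem 1 _ b i hp).mdifferentiableAt one_ne_zero)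
  let c (V : Π q : N, TangentSpace I (f q)) (i) (q : N) : ℝ := b.repr (alongCoord f V p q) i
  have hc {V : Π q : N, TangentSpace I (f q)} (hV : AlongDiffAt J f V p) (i) :
      MDifferentiableAt J 𝓘(ℝ) (c V i) p := by
    have h1 := (alongDiffAt_iff.1 hV).2
    exact MDifferentiableAt.comp (I' := 𝓘(ℝ, E)) p
      (LinearMap.toContinuousLinearMap (b.coord i)).mdifferentiableAt h1
  have key {V : Π q : N, TangentSpace I (f q)} (hV : AlongDiffAt J f V p) :
      Φ V = ∑ i, c V i p • Φ (e i) := by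
    rw [hΦ.congr hV (.sum Finset.univ hf fun i ↦ (he i).smul (hc hV i))]
    · rw [hΦ.sum _ hf fun i ↦ (he i).smul (hc hV i)]
      exact Finset.sum_congr rfl fun i _ ↦ hΦ.smul (hc hV i) (he i)
    · filter_upwards [hf.continuousAt (t.open_baseSet.mem_nhds hp)] with q hq
      have h1 := (t.basisAt b hq).sum_repr (V q)
      rw [← h1]
      refine Finset.sum_congr rfl fun i _ ↦ ?_
      simp only [e, c, t.localFrame_apply_of_mem_baseSet b hq]
      congr 1
  rw [key hV, key hW]
  simp only [c, alongCoord, h]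

end TensorialAlong
end Along

end

/-! ### The covariant derivative along a map -/

section

section CovDerivAlong

variable [FiniteDimensional ℝ E] {g : Metric I M} {f : N → M} {p : N}
  {V W : Π q : N, TangentSpace I (f q)}

lemma covDerivAlong_eq (V : Π q : N, TangentSpace I (f q)) (u : TangentSpace J p) :
    covDerivAlong g f V p u =
      (trivializationAt E (fun x : M ↦ TangentSpace I x) (f p)).symmL ℝ (f p)
        (d% (alongCoord f V p) p u) +
      leviCivita g (FiberBundle.extend E (V p)) (f p) (mfderiv J I f p u) := by
  rw [Trivialization.symmL_apply _ (FiberBundle.mem_baseSet_trivializationAt' (f p))]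
  rfl

lemma symmL_alongCoord_self (V : Π q : N, TangentSpace I (f q)) :
    (trivializationAt E (fun x : M ↦ TangentSpace I x) (f p)).symmL ℝ (f p) (alongCoord f V p p)
      = V p := by
  have hp := FiberBundle.mem_baseSet_trivializationAt' (F := E) (E := fun x : M ↦ TangentSpace I x) (f p)
  rw [Trivialization.symmL_apply _ hp]
  exact Trivialization.symm_apply_apply_mk _ hp _

lemma leviCivita_congr {x : M} {Y Z : Π x : M, TangentSpace I x} (hY : MDiffAt (T% Y) x)
    (hZ : MDiffAt (T% Z) x) (h : ∀ᶠ y in 𝓝 x, Y y = Z y) : leviCivita g Y x = leviCivita g Z x :=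
  (leviCivita g).isCovariantDerivativeOnUniv.congr_of_eventuallyEq hY hZ univ_mem h

/-- The extension is linear in the vector over the base set of the trivialization, so the comparison
is made on a neighbourhood. -/
lemma leviCivita_extend_smul {x : M} (c : ℝ) (v : TangentSpace I x) :
    leviCivita g (FiberBundle.extend E (c • v)) x =
      leviCivita g (fun y ↦ c • FiberBundle.extend E v y) x := by
  have hx := FiberBundle.mem_baseSet_trivializationAt' (F := E) (E := fun x : M ↦ TangentSpace I x) x
  have h1 := ((trivializationAt E (fun x : M ↦ TangentSpace I x) x).linear ℝ hx).2 c v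
  refine leviCivita_congr (mdiff_extend _) (mdiff_extend v).smul_const_section ?_
  filter_upwards [(trivializationAt E (fun x : M ↦ TangentSpace I x) x).open_baseSet.mem_nhds hx]
    with y hy
  simp only [FiberBundle.extend]
  rw [← Trivialization.symmL_apply (R := ℝ) _ hy, ← Trivialization.symmL_apply (R := ℝ) _ hy,
    ← map_smul]
  exact congrArg _ h1

lemma leviCivita_extend_add {x : M} (v w : TangentSpace I x) :
    leviCivita g (FiberBundle.extend E (v + w)) x =
      leviCivita g (FiberBundle.extend E v) x + leviCivita g (FiberBundle.extend E w) x := by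
  have hx := FiberBundle.mem_baseSet_trivializationAt' (F := E) (E := fun x : M ↦ TangentSpace I x) x
  have h1 := ((trivializationAt E (fun x : M ↦ TangentSpace I x) x).linear ℝ hx).1 v w
  rw [← leviCivita_add (mdiff_extend v) (mdiff_extend w)]
  refine leviCivita_congr (mdiff_extend _)
    (mdifferentiableAt_add_section (mdiff_extend v) (mdiff_extend w)) ?_
  filter_upwards [(trivializationAt E (fun x : M ↦ TangentSpace I x) x).open_baseSet.mem_nhds hx]
    with y hy
  simp only [FiberBundle.extend]
  rw [← Trivialization.symmL_apply (R := ℝ) _ hy, ← Trivialization.symmL_apply (R := ℝ) _ hy,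
    ← Trivialization.symmL_apply (R := ℝ) _ hy, ← map_add]
  exact congrArg _ h1

lemma covDerivAlong_add (hV : AlongDiffAt J f V p) (hW : AlongDiffAt J f W p)
    (u : TangentSpace J p) :
    covDerivAlong g f (fun q ↦ V q + W q) p u =
      covDerivAlong g f V p u + covDerivAlong g f W p u := by
  rw [covDerivAlong_eq, covDerivAlong_eq, covDerivAlong_eq,
    mvfderiv_congr (alongCoord_add hV.mdiff.continuousAt),
    mvfderiv_fun_add (alongDiffAt_iff.1 hV).2 (alongDiffAt_iff.1 hW).2, leviCivita_extend_add,
    add_apply, add_apply, map_add]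
  module

lemma covDerivAlong_smul {F : N → ℝ} (hF : MDifferentiableAt J 𝓘(ℝ) F p)
    (hV : AlongDiffAt J f V p) (u : TangentSpace J p) :
    covDerivAlong g f (fun q ↦ F q • V q) p u =
      F p • covDerivAlong g f V p u + d% F p u • V p := by
  have h1 := leviCivita_smul (g := g) (F := fun _ ↦ F p) (mdiff_extend (V p)) mdifferentiableAt_const
    (mfderiv J I f p u)
  rw [mvfderiv_const, zero_apply, zero_smul, add_zero] at h1
  rw [covDerivAlong_eq, covDerivAlong_eq,
    mvfderiv_congr (alongCoord_smul hV.mdiff.continuousAt F),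
    mvfderiv_fun_smul hF (alongDiffAt_iff.1 hV).2, leviCivita_extend_smul, h1]
  simp only [add_apply, smul_apply, map_add, map_smul, ContinuousLinearMap.smulRight_apply,
    symmL_alongCoord_self]
  module

/-- The chain rule for the covariant derivative of a vector field along `f`. -/
lemma covDerivAlong_comp {Z : Π x : M, TangentSpace I x} (hf : MDifferentiableAt J I f p)
    (hZ : MDiffAt (T% Z) (f p)) (u : TangentSpace J p) :
    covDerivAlong g f (fun q ↦ Z (f q)) p u = leviCivita g Z (f p) (mfderiv J I f p u) := by
  -- The discrepancy is tensorial in Z, so Z may be replaced by the extension of Z (f p). Its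
  -- coordinates are constant along f, which kills the derivative term.
  have hT : TensorialAt I E (fun Z ↦ covDerivAlong g f (fun q ↦ Z (f q)) p u -
      leviCivita g Z (f p) (mfderiv J I f p u)) (f p) := by
    constructor
    · intro F Z hF hZ
      have h1 := covDerivAlong_smul (g := g) (F := F ∘ f) (hF.comp p hf) (alongDiffAt_comp hf hZ) u
      have h2 := leviCivita_smul (g := g) hZ hF (mfderiv J I f p u)
      rw [mvfderiv_comp p hF hf] at h1
      simp only [Function.comp_apply, ContinuousLinearMap.comp_apply] at h1
      simp only [Pi.smul_apply']
      rw [h1, show F • Z = fun y ↦ F y • Z y from rfl, h2]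
      module
    · intro Z Z' hZ hZ'
      simp only [Pi.add_apply]
      rw [covDerivAlong_add (alongDiffAt_comp hf hZ) (alongDiffAt_comp hf hZ'),
        show Z + Z' = fun y ↦ Z y + Z' y from rfl, leviCivita_add hZ hZ', add_apply]
      module
  have h1 := extend_congr hT hZ
  rw [← sub_eq_zero, ← h1, covDerivAlong_eq, FiberBundle.extend_apply_self, add_sub_cancel_right]
  have h2 : alongCoord f (fun q ↦ FiberBundle.extend E (Z (f p)) (f q)) p =ᶠ[𝓝 p]
      fun _ ↦ (trivializationAt E (fun x : M ↦ TangentSpace I x) (f p) (TotalSpace.mk' E (f p) (Z (f p)))).2 := by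
    have hp := FiberBundle.mem_baseSet_trivializationAt' (F := E) (E := fun x : M ↦ TangentSpace I x) (f p)
    filter_upwards [hf.continuousAt ((trivializationAt E
      (fun x : M ↦ TangentSpace I x) (f p)).open_baseSet.mem_nhds hp)] with q hq
    simp only [alongCoord, FiberBundle.extend]
    rw [Trivialization.apply_mk_symm _ hq]
  rw [mvfderiv_congr h2, mvfderiv_const, zero_apply, map_zero]

lemma alongDiffAt_extend (hf : MDifferentiableAt J I f p) (v : TangentSpace I (f p)) :
    AlongDiffAt J f (fun q ↦ FiberBundle.extend E v (f q)) p :=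
  alongDiffAt_comp hf (mdiff_extend v)

lemma TensorialAlong.extend {A : Type*} [AddCommGroup A] [Module ℝ A]
    {Φ : (Π q : N, TangentSpace I (f q)) → A} (hΦ : TensorialAlong J f p Φ)
    (hV : AlongDiffAt J f V p) :
    Φ V = Φ (fun q ↦ FiberBundle.extend E (V p) (f q)) :=
  hΦ.pointwise hV (alongDiffAt_extend hV.mdiff _) (by simp)

lemma AlongDiffAt.endo {A : Π x : M, TangentSpace I x →L[ℝ] TangentSpace I x}
    (hA : ContMDiffAt I (I.prod 𝓘(ℝ, E →L[ℝ] E)) ∞ (fun x ↦ TotalSpace.mk' (E →L[ℝ] E)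
      (E := fun x : M ↦ TangentSpace I x →L[ℝ] TangentSpace I x) x (A x)) (f p))
    (hV : AlongDiffAt J f V p) : AlongDiffAt J f (fun q ↦ A (f q) (V q)) p :=
  MDifferentiableAt.clm_bundle_apply (F₁ := E) (F₂ := E) (b := f)
    ((hA.mdifferentiableAt (by simp)).comp p hV.mdiff) hV

/-- The difference ∇(AV) - A∇V is tensorial in V, so V may be taken as the pullback of a field on M,
where the chain rule gives `nablaEndo`. -/
lemma covDerivAlong_endo {A : Π x : M, TangentSpace I x →L[ℝ] TangentSpace I x}
    (hA : ContMDiffAt I (I.prod 𝓘(ℝ, E →L[ℝ] E)) ∞ (fun x ↦ TotalSpace.mk' (E →L[ℝ] E)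
      (E := fun x : M ↦ TangentSpace I x →L[ℝ] TangentSpace I x) x (A x)) (f p))
    (hV : AlongDiffAt J f V p) (u : TangentSpace J p) :
    covDerivAlong g f (fun q ↦ A (f q) (V q)) p u =
      nablaEndo g A (f p) (mfderiv J I f p u) (V p) + A (f p) (covDerivAlong g f V p u) := by
  have hA' : DiffEndoAt A (f p) := fun _ hX ↦ MDifferentiableAt.clm_bundle_apply (F₁ := E) (F₂ := E)
    (hA.mdifferentiableAt (by simp)) hX
  have hT : TensorialAlong J f p (fun V ↦ covDerivAlong g f (fun q ↦ A (f q) (V q)) p u -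
      A (f p) (covDerivAlong g f V p u)) := by
    constructor
    · intro F V hF hV
      simp only [map_smul]
      rw [covDerivAlong_smul hF (hV.endo hA), covDerivAlong_smul hF hV, map_add, map_smul, map_smul]
      module
    · intro V W hV hW
      simp only [map_add]
      rw [covDerivAlong_add (hV.endo hA) (hW.endo hA), covDerivAlong_add hV hW, map_add]
      module
  have h := hT.extend hV
  have hv := mdiff_extend (V p)
  simp only at h
  rw [covDerivAlong_comp (Z := fun y ↦ A y (FiberBundle.extend E (V p) y)) hV.mdiff (hA' _ hv),
    covDerivAlong_comp (Z := FiberBundle.extend E (V p)) hV.mdiff hv, leviCivita_endo hA' hv,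
    FiberBundle.extend_apply_self, add_sub_cancel_right] at h
  rw [← h, sub_add_cancel]

lemma AlongDiffAt.inner (hV : AlongDiffAt J f V p) (hW : AlongDiffAt J f W p) :
    MDifferentiableAt J 𝓘(ℝ) (fun q ↦ g.inner (f q) (V q) (W q)) p := by
  have : MDifferentiableAt J (I.prod 𝓘(ℝ))
      (fun m ↦ TotalSpace.mk' ℝ (E := Bundle.Trivial M ℝ) (f m) (g.inner (f m) (V m) (W m))) p := by
    apply MDifferentiableAt.clm_bundle_apply₂ (F₁ := E) (F₂ := E) (b := f)
    · exact ((g.contMDiff (f p)).mdifferentiableAt (by simp)).comp p hV.mdiff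
    · exact hV
    · exact hW
  rw [mdifferentiableAt_totalSpace] at this
  exact this.2

/-- The defect is tensorial in V and in W separately; reducing one after the other leaves metric
compatibility on M. -/
lemma mvfderiv_inner_along (hV : AlongDiffAt J f V p) (hW : AlongDiffAt J f W p)
    (u : TangentSpace J p) :
    d% (fun q ↦ g.inner (f q) (V q) (W q)) p u =
      g.inner (f p) (covDerivAlong g f V p u) (W p) +
        g.inner (f p) (V p) (covDerivAlong g f W p u) := by
  have hT {W : Π q : N, TangentSpace I (f q)} (hW : AlongDiffAt J f W p) :
      TensorialAlong J f p (fun V ↦ d% (fun q ↦ g.inner (f q) (V q) (W q)) p u -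
        (g.inner (f p) (covDerivAlong g f V p u) (W p) +
        g.inner (f p) (V p) (covDerivAlong g f W p u))) := by
    constructor
    · intro F V hF hV
      simp only [map_smul, smul_apply, covDerivAlong_smul hF hV, map_add, add_apply, smul_eq_mul,
        mvfderiv_fun_mul hF (hV.inner (g := g) hW)]
      ring
    · intro V V' hV hV'
      simp only [map_add, add_apply, covDerivAlong_add hV hV',
        mvfderiv_fun_add (hV.inner (g := g) hW) (hV'.inner (g := g) hW)]
      ring
  have hT' {V : Π q : N, TangentSpace I (f q)} (hV : AlongDiffAt J f V p) :
      TensorialAlong J f p (fun W ↦ d% (fun q ↦ g.inner (f q) (V q) (W q)) p u -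
        (g.inner (f p) (covDerivAlong g f V p u) (W p) +
        g.inner (f p) (V p) (covDerivAlong g f W p u))) := by
    constructor
    · intro F W hF hW
      simp only [map_smul, covDerivAlong_smul hF hW, map_add, smul_eq_mul,
        mvfderiv_fun_mul hF (hV.inner (g := g) hW), add_apply, smul_apply]
      ring
    · intro W W' hW hW'
      simp only [map_add, add_apply, covDerivAlong_add hW hW',
        mvfderiv_fun_add (hV.inner (g := g) hW) (hV.inner (g := g) hW')]
      ring
  have hf := hV.mdiff
  have h1 := (hT hW).extend hV
  have h2 := (hT' (alongDiffAt_extend hf (V p))).extend hW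
  have h3 := leviCivita_metric (g := g) (mdiff_extend (mfderiv J I f p u)) (mdiff_extend (V p))
    (mdiff_extend (W p))
  have h4 := mvfderiv_comp p (g.mdiff (mdiff_extend (V p)) (mdiff_extend (W p))) hf
  have h5 := congrArg (fun A ↦ A u) h4
  simp only [ContinuousLinearMap.comp_apply, Function.comp_def] at h5
  simp only [FiberBundle.extend_apply_self] at h1 h2 h3
  rw [covDerivAlong_comp hf (mdiff_extend (V p))] at h1 h2
  rw [covDerivAlong_comp hf (mdiff_extend (W p))] at h2
  rw [← sub_eq_zero, h1, h2, h5, h3, sub_self]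

end CovDerivAlong

end

/-! ### Torsion-freeness along a map, through Hessians -/

section

section Torsion

variable [FiniteDimensional ℝ E] {g : Metric I M} {f : N → M} {p : N}
  {V : Π q : N, TangentSpace I (f q)}

lemma AlongDiffAt.mvfderiv {F : M → ℝ} (hF : CMDiffAt ∞ F (f p)) (hV : AlongDiffAt J f V p) :
    MDifferentiableAt J 𝓘(ℝ) (fun q ↦ d% F (f q) (V q)) p := by
  have h1 : CMDiffAt ∞ (inTangentCoordinates I 𝓘(ℝ) id F (mfderiv I 𝓘(ℝ) F) (f p)) (f p) :=
    hF.mfderiv_const (by simp)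
  have h2 := (h1.mdifferentiableAt (by simp)).comp p hV.mdiff
  have h3 := MDifferentiableAt.clm_apply_of_inCoordinates h2 hV
    ((hF.mdifferentiableAt (by simp)).comp p hV.mdiff)
  rw [mdifferentiableAt_totalSpace] at h3
  simpa [TangentBundle.trivializationAt_apply] using! h3.2

/-- The Hessian of a function, evaluated on a vector field along a map. -/
lemma mvfderiv_mvfderiv_along {F : M → ℝ} (hF : CMDiffAt ∞ F (f p)) (hV : AlongDiffAt J f V p)
    (u : TangentSpace J p) :
    d% (fun q ↦ d% F (f q) (V q)) p u - d% F (f p) (covDerivAlong g f V p u) =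
      d% (fun y ↦ d% F y (FiberBundle.extend E (V p) y)) (f p) (mfderiv J I f p u) -
        d% F (f p) (leviCivita g (FiberBundle.extend E (V p)) (f p) (mfderiv J I f p u)) := by
  have hT : TensorialAlong J f p (fun V ↦ d% (fun q ↦ d% F (f q) (V q)) p u -
      d% F (f p) (covDerivAlong g f V p u)) := by
    constructor
    · intro c V hc hV
      simp only [map_smul, covDerivAlong_smul hc hV, map_add, smul_eq_mul,
        mvfderiv_fun_mul hc (hV.mvfderiv hF), add_apply, smul_apply]
      ring
    · intro V W hV hW
      simp only [map_add, covDerivAlong_add hV hW,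
        mvfderiv_fun_add (hV.mvfderiv hF) (hW.mvfderiv hF), add_apply]
      ring
  have h := hT.extend hV
  simp only at h
  have h1 := (contMDiffAt_mvfderiv_apply hF (smoothAt_extend (V p))).mdifferentiableAt (by simp)
  have h2 := mvfderiv_comp p h1 hV.mdiff
  rw [h, covDerivAlong_comp hV.mdiff (mdiff_extend _)]
  exact congrArg (· - _) (congrArg (fun A ↦ A u) h2)

lemma hessian_symm {F : M → ℝ} {x : M} (hF : CMDiffAt ∞ F x) (u v : TangentSpace I x) :
    d% (fun y ↦ d% F y (FiberBundle.extend E v y)) x u -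
        d% F x (leviCivita g (FiberBundle.extend E v) x u) =
    d% (fun y ↦ d% F y (FiberBundle.extend E u y)) x v -
        d% F x (leviCivita g (FiberBundle.extend E u) x v) := by
  have h1 := mvfderiv_mlieBracket (smoothAt_extend u) (smoothAt_extend v) hF
  rw [← leviCivita_torsion (g := g) (mdiff_extend u) (mdiff_extend v)] at h1
  simp only [FiberBundle.extend_apply_self, map_sub] at h1
  linarith

/-- Linear functionals composed with a chart already separate tangent vectors. -/
lemma eq_zero_of_mvfderiv {x : M} {v : TangentSpace I x}
    (h : ∀ F : M → ℝ, CMDiffAt ∞ F x → d% F x v = 0) : v = 0 := by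
  have hc : ContMDiffAt I 𝓘(ℝ, E) ∞ (extChartAt I x) x := contMDiffAt_extChartAt
  have hinv := isInvertible_mfderiv_extChartAt (I := I) (mem_extChartAt_source (I := I) x)
  have h0 : mfderiv I 𝓘(ℝ, E) (extChartAt I x) x v = 0 := by
    refine (SeparatingDual.eq_zero_of_forall_dual_eq_zero (R := ℝ) (V := E)
      (x := mfderiv I 𝓘(ℝ, E) (extChartAt I x) x v) fun ℓ ↦ ?_)
    have h1 := h (ℓ ∘ extChartAt I x) (ℓ.contMDiff.contMDiffAt.comp x hc)
    rw [mvfderiv_comp x ℓ.mdifferentiableAt (hc.mdifferentiableAt (by simp))] at h1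
    have h2 : d% (ℓ : E → ℝ) (extChartAt I x x) = ℓ := by
      ext w
      simp [mvfderiv, mfderiv_eq_fderiv]
      rfl
    rw [h2] at h1
    exact h1
  exact hinv.injective (by rw [h0, map_zero])

lemma alongDiffAt_mfderiv (hf : ContMDiffAt J I ∞ f p) {Y : Π q : N, TangentSpace J q}
    (hY : SmoothAt Y p) : AlongDiffAt J f (fun q ↦ mfderiv J I f q (Y q)) p :=
  (contMDiffAt_mfderiv_apply hf hY).mdifferentiableAt (by simp)

variable [FiniteDimensional ℝ E']

/-- Test on functions F: the Hessian of F at (df X, df Y) is symmetric, so only the commutator of X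
and Y on F ∘ f remains, and that is their bracket. -/
lemma covDerivAlong_torsion (hf : ContMDiffAt J I ∞ f p) {X Y : Π q : N, TangentSpace J q}
    (hX : SmoothAt X p) (hY : SmoothAt Y p) :
    covDerivAlong g f (fun q ↦ mfderiv J I f q (Y q)) p (X p) -
      covDerivAlong g f (fun q ↦ mfderiv J I f q (X q)) p (Y p) =
        mfderiv J I f p (mlieBracket J X Y p) := by
  rw [← sub_eq_zero]
  refine eq_zero_of_mvfderiv fun F hF ↦ ?_
  have hFf : ContMDiffAt J 𝓘(ℝ) ∞ (F ∘ f) p := hF.comp p hf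
  have h1 := mvfderiv_mvfderiv_along (g := g) hF (alongDiffAt_mfderiv hf hY) (X p)
  have h2 := mvfderiv_mvfderiv_along (g := g) hF (alongDiffAt_mfderiv hf hX) (Y p)
  have h3 := hessian_symm (g := g) hF (mfderiv J I f p (X p)) (mfderiv J I f p (Y p))
  have h4 := mvfderiv_mlieBracket hX hY hFf
  have h5 (Z : Π q : N, TangentSpace J q) :
      (fun q ↦ d% (F ∘ f) q (Z q)) =ᶠ[𝓝 p] fun q ↦ d% F (f q) (mfderiv J I f q (Z q)) := by
    have e1 := hf.continuousAt ((contMDiffAt_iff_contMDiffAt_nhds (n := 1) (by simp)).1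
      (hF.of_le (by simp)))
    have e2 := (contMDiffAt_iff_contMDiffAt_nhds (n := 1) (by simp)).1 (hf.of_le (by simp))
    filter_upwards [e1, e2] with q hq hq'
    rw [mvfderiv_comp q (ContMDiffAt.mdifferentiableAt hq one_ne_zero)
      (hq'.mdifferentiableAt one_ne_zero)]
    rfl
  rw [mvfderiv_congr (h5 X), mvfderiv_congr (h5 Y), mvfderiv_comp p (hF.mdifferentiableAt (by simp))
    (hf.mdifferentiableAt (by simp)), ContinuousLinearMap.comp_apply] at h4
  rw [map_sub, map_sub]
  linarith

end Torsion

end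

/-! ### Smoothness of tangential parts, h₁ and h₂ -/

section

lemma contMDiffAt_det {ι : Type*} [Fintype ι] [DecidableEq ι] {G : M → Matrix ι ι ℝ} {x : M}
    (hG : ∀ i j, CMDiffAt ∞ (fun y ↦ G y i j) x) : CMDiffAt ∞ (fun y ↦ (G y).det) x := by
  simp only [Matrix.det_apply']
  exact contMDiffAt_finsetSum fun s _ ↦ contMDiffAt_const.mul
    (contMDiffAt_finsetProd fun i _ ↦ hG _ _)

variable [FiniteDimensional ℝ E]

lemma Metric.eq_zero_of_inner_self {g : Metric I M} {x : M} {v : TangentSpace I x}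
    (h : g.inner x v v = 0) : v = 0 := by
  by_contra hv
  exact ne_of_gt (g.pos x v hv) h

/-- The products of two smooth vector fields along `f` are smooth. -/
lemma contMDiffAt_inner_along {g : Metric I M} {f : N → M} {p : N}
    {V W : Π q : N, TangentSpace I (f q)}
    (hf : ContMDiffAt J I ∞ f p)
    (hV : ContMDiffAt J I.tangent ∞
      (fun q ↦ TotalSpace.mk' E (E := fun x : M ↦ TangentSpace I x) (f q) (V q)) p)
    (hW : ContMDiffAt J I.tangent ∞
      (fun q ↦ TotalSpace.mk' E (E := fun x : M ↦ TangentSpace I x) (f q) (W q)) p) :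
    CMDiffAt ∞ (fun q ↦ g.inner (f q) (V q) (W q)) p := by
  have : ContMDiffAt J (I.prod 𝓘(ℝ)) ∞
      (fun m ↦ TotalSpace.mk' ℝ (E := Bundle.Trivial M ℝ) (f m) (g.inner (f m) (V m) (W m))) p := by
    apply ContMDiffAt.clm_bundle_apply₂ (F₁ := E) (F₂ := E) (b := f)
    · exact (g.contMDiff (f p)).comp p hf
    · exact hV
    · exact hW
  rw [contMDiffAt_totalSpace] at this
  exact this.2

/-- A vector field is smooth if its products with smooth vector fields are. -/
lemma smoothAt_of_inner {g : Metric I M} {x : M} {W : Π x : M, TangentSpace I x}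
    (h : ∀ Z : Π x : M, TangentSpace I x, SmoothAt Z x →
      CMDiffAt ∞ (fun y ↦ g.inner y (W y) (Z y)) x) : SmoothAt W x := by
  let t := trivializationAt E (fun x : M ↦ TangentSpace I x) x
  have hx : x ∈ t.baseSet := FiberBundle.mem_baseSet_trivializationAt' x
  let b := Module.finBasis ℝ E
  let e := t.localFrame b
  have he (i) : SmoothAt (e i) x := contMDiffAt_localFrame_of_mem ∞ _ b i hx
  -- The Gram matrix of a local frame is invertible by definiteness. Its products with the frame
  -- determine W, and Cramer's rule expresses the coefficients of W as quotients of smooth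
  -- determinants.
  let G (y : M) : Matrix _ _ ℝ := Matrix.of fun j i ↦ g.inner y (e i y) (e j y)
  have hG (i j) : CMDiffAt ∞ (fun y ↦ G y i j) x :=
    contMDiffAt_inner_along (f := id) contMDiffAt_id (he j) (he i)
  have hdet {y : M} (hy : y ∈ t.baseSet) : (G y).det ≠ 0 := by
    intro h0
    obtain ⟨v, hv, hGv⟩ := Matrix.exists_mulVec_eq_zero_iff.2 h0
    have h1 : ∑ i, v i • e i y = 0 := by
      apply g.eq_zero_of_inner_self
      have h2 (j) : g.inner y (∑ i, v i • e i y) (e j y) = 0 := by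
        have := congrFun hGv j
        simp only [Matrix.mulVec, dotProduct, G, Matrix.of_apply, Pi.zero_apply] at this
        rw [← this]
        simp [mul_comm]
      rw [map_sum]
      exact Finset.sum_eq_zero fun j _ ↦ by rw [map_smul, h2, smul_zero]
    refine hv (funext fun i ↦ ?_)
    have h3 := Fintype.linearIndependent_iff.1 (t.basisAt b hy).linearIndependent v
    refine h3 ?_ i
    rw [← h1]
    exact Finset.sum_congr rfl fun i _ ↦ by
      simp only [e, t.localFrame_apply_of_mem_baseSet b hy]
  refine (contMDiffAt_iff_localFrameCoeff b hx).2 fun i ↦ ?_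
  let B (y : M) (j) : ℝ := g.inner y (W y) (e j y)
  have h4 : CMDiffAt ∞ (fun y ↦ ((G y).det)⁻¹ * ((G y).updateCol i (B y)).det) x := by
    refine ((contMDiffAt_det hG).inv₀ (hdet hx)).mul (contMDiffAt_det fun k l ↦ ?_)
    by_cases hl : l = i
    · subst hl
      simpa using h _ (he k)
    · simpa [Matrix.updateCol_ne hl] using hG k l
  refine h4.congr_of_eventuallyEq ?_
  filter_upwards [t.open_baseSet.mem_nhds hx] with y hy
  let c (i) : ℝ := t.localFrameCoeff I b i y (W y)
  have h5 : W y = ∑ i, c i • e i y := t.eq_sum_localFrameCoeff_smul (I := I) (b := b) (s := W) hy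
  have h6 : (G y).mulVec c = B y := by
    ext j
    simp only [B]
    rw [h5]
    simp [Matrix.mulVec, dotProduct, G, mul_comm]
  have h7 : (G y).cramer (B y) = (G y).det • c := by
    rw [← h6, Matrix.cramer_eq_adjugate_mulVec, Matrix.mulVec_mulVec, Matrix.adjugate_mul,
      Matrix.smul_mulVec, Matrix.one_mulVec]
  rw [← Matrix.cramer_apply, h7, Pi.smul_apply, smul_eq_mul, inv_mul_cancel_left₀ (hdet hy)]
  rfl

variable [FiniteDimensional ℝ E']

lemma smoothAt_tangential {g : Metric I M} {gN : Metric J N} {f : N → M} {p : N}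
    (hf : ContMDiffAt J I ∞ f p) {V : Π q : N, TangentSpace I (f q)}
    (hV : ContMDiffAt J I.tangent ∞
      (fun q ↦ TotalSpace.mk' E (E := fun x : M ↦ TangentSpace I x) (f q) (V q)) p) :
    SmoothAt (fun q ↦ tangential g gN f q (V q)) p := by
  refine smoothAt_of_inner (g := gN) fun Z hZ ↦ ?_
  simp only [inner_tangential]
  exact contMDiffAt_inner_along hf hV (contMDiffAt_mfderiv_apply hf hZ)

namespace AlmostContactMetric

variable {g : Metric I M} {S : AlmostContactMetric g} {gN : Metric J N} {f : N → M} {p : N}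
  {Y : Π q : N, TangentSpace J q}

lemma contMDiffAt_h_mfderiv (hf : ContMDiffAt J I ∞ f p) (hY : SmoothAt Y p) :
    ContMDiffAt J I.tangent ∞ (fun q ↦ TotalSpace.mk' E (E := fun x : M ↦ TangentSpace I x) (f q)
      (S.h (f q) (mfderiv J I f q (Y q)))) p :=
  ContMDiffAt.clm_bundle_apply (F₁ := E) (F₂ := E) (b := f)
    ((contMDiffAt_endo fun _ ↦ smoothAt_h).comp p hf) (contMDiffAt_mfderiv_apply hf hY)

lemma smoothAt_h₁ (hf : ContMDiffAt J I ∞ f p) (hY : SmoothAt Y p) :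
    SmoothAt (fun q ↦ S.h₁ gN f q (Y q)) p :=
  smoothAt_tangential hf (contMDiffAt_h_mfderiv hf hY)

lemma smoothAt_h₂ (hf : ContMDiffAt J I ∞ f p) (hY : SmoothAt Y p) :
    SmoothAt (fun q ↦ S.h₂ gN f q (Y q)) p := by
  have hφ {V : Π q : N, TangentSpace I (f q)} (hV : ContMDiffAt J I.tangent ∞
      (fun q ↦ TotalSpace.mk' E (E := fun x : M ↦ TangentSpace I x) (f q) (V q)) p) :=
    smoothAt_tangential (g := g) (gN := gN) hf (V := fun q ↦ S.φ (f q) (V q))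
      (ContMDiffAt.clm_bundle_apply (F₁ := E) (F₂ := E) (b := f) ((S.smooth_φ _).comp p hf) hV)
  have h3 := (hφ (contMDiffAt_mfderiv_apply hf (smoothAt_h₁ (gN := gN) (S := S) hf hY))).sub_section
    (hφ (contMDiffAt_h_mfderiv (S := S) hf hY))
  have h4 : (fun q ↦ S.h₂ gN f q (Y q)) = (fun q ↦ tangential g gN f q
      (S.φ (f q) (mfderiv J I f q (S.h₁ gN f q (Y q))))) - fun q ↦ tangential g gN f q
      (S.φ (f q) (S.h (f q) (mfderiv J I f q (Y q)))) := by
    ext q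
    simp [h₂]
  rw [h4]
  exact h3

end AlmostContactMetric

end

/-! ### Second fundamental form and Legendrian submanifolds -/

section

variable [FiniteDimensional ℝ E] [FiniteDimensional ℝ E'] {g : Metric I M} {gN : Metric J N}
  {f : N → M} {p : N} {X Y Z : Π q : N, TangentSpace J q}

section SecondFundamentalForm

lemma covDerivAlong_mfderiv (X Y : Π q : N, TangentSpace J q) :
    covDerivAlong g f (fun q ↦ mfderiv J I f q (Y q)) p (X p) =
      mfderiv J I f p (leviCivita gN Y p (X p)) + secondFF g gN f X Y p := by
  rw [secondFF, add_sub_cancel]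

lemma secondFF_comm (hf : ContMDiffAt J I ∞ f p) (hX : SmoothAt X p) (hY : SmoothAt Y p) :
    secondFF g gN f X Y p = secondFF g gN f Y X p := by
  have h1 := covDerivAlong_torsion (g := g) hf hX hY
  rw [← leviCivita_torsion (g := gN) hX.mdiff hY.mdiff, map_sub, sub_eq_sub_iff_sub_eq_sub] at h1
  exact h1

/-- Compare metric compatibility along f with that on N for the same function g(Y,Z). -/
lemma inner_secondFF_skew (hf : ContMDiffAt J I ∞ f p)
    (hg : ∀ (q : N) (u v : TangentSpace J q),
      g.inner (f q) (mfderiv J I f q u) (mfderiv J I f q v) = gN.inner q u v)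
    (hX : SmoothAt X p) (hY : SmoothAt Y p) (hZ : SmoothAt Z p) :
    g.inner (f p) (secondFF g gN f X Y p) (mfderiv J I f p (Z p)) =
      -g.inner (f p) (secondFF g gN f X Z p) (mfderiv J I f p (Y p)) := by
  have h1 := mvfderiv_inner_along (g := g) (alongDiffAt_mfderiv hf hY) (alongDiffAt_mfderiv hf hZ)
    (X p)
  have h2 := leviCivita_metric (g := gN) hX.mdiff hY.mdiff hZ.mdiff
  simp only [hg, covDerivAlong_mfderiv (gN := gN), map_add, add_apply] at h1
  rw [g.symm _ (secondFF g gN f X Z p)]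
  linarith

/-- The second fundamental form of an isometric immersion is normal. -/
lemma inner_secondFF (hf : ContMDiffAt J I ∞ f p)
    (hg : ∀ (q : N) (u v : TangentSpace J q),
      g.inner (f q) (mfderiv J I f q u) (mfderiv J I f q v) = gN.inner q u v)
    (hX : SmoothAt X p) (hY : SmoothAt Y p) (w : TangentSpace J p) :
    g.inner (f p) (secondFF g gN f X Y p) (mfderiv J I f p w) = 0 := by
  have hZ := smoothAt_extend w
  -- Symmetric in the first two slots, skew in the last two: three permutations force zero.
  have h1 := inner_secondFF_skew hf hg hX hY hZ
  have h2 := inner_secondFF_skew hf hg hZ hX hY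
  have h3 := inner_secondFF_skew hf hg hY hZ hX
  rw [secondFF_comm hf hX hZ] at h1
  rw [secondFF_comm hf hZ hY] at h2
  rw [secondFF_comm hf hY hX] at h3
  rw [FiberBundle.extend_apply_self] at h1 h3
  linarith

end SecondFundamentalForm

namespace AlmostContactMetric

variable {S : AlmostContactMetric g}

namespace IsLegendrian

lemma η_mfderiv (hf : S.IsLegendrian gN f) (u : TangentSpace J p) :
    S.η (f p) (mfderiv J I f p u) = 0 := by
  rw [← S.inner_ξ_left, hf.normal]

/-- Differentiate g(df Y, ξ) = 0. -/
lemma inner_covDerivAlong_ξ (hf : S.IsLegendrian gN f) (hY : SmoothAt Y p) (u : TangentSpace J p) :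
    g.inner (f p) (covDerivAlong g f (fun q ↦ mfderiv J I f q (Y q)) p u) (S.ξ (f p)) =
      -g.inner (f p) (mfderiv J I f p (Y p))
        (S.τ (f p) (mfderiv J I f p u) - S.φ (f p) (mfderiv J I f p u)) := by
  have hd : MDifferentiableAt J I f p := hf.smooth.mdifferentiable (by simp) p
  have h1 := mvfderiv_inner_along (g := g) (alongDiffAt_mfderiv (hf.smooth p) hY)
    (alongDiffAt_comp hd S.mdiff_ξ) u
  simp only [S.inner_ξ_right (mfderiv J I f _ _), hf.η_mfderiv, mvfderiv_const, zero_apply] at h1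
  rw [covDerivAlong_comp hd S.mdiff_ξ, S.nabla_ξ] at h1
  linarith

/-- This is the vanishing of dη on N: skew-symmetrize the previous formula, where τ cancels by
self-adjointness and the bracket is tangent to N, hence killed by η. -/
lemma inner_φ_mfderiv (hf : S.IsLegendrian gN f) (hS : S.IsContactMetric) (u v : TangentSpace J p) :
    g.inner (f p) (mfderiv J I f p u) (S.φ (f p) (mfderiv J I f p v)) = 0 := by
  have hu := smoothAt_extend u
  have hv := smoothAt_extend v
  have h1 := hf.inner_covDerivAlong_ξ hv u
  have h2 := hf.inner_covDerivAlong_ξ hu v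
  have h3 := congrArg (S.η (f p)) (covDerivAlong_torsion (g := g) (hf.smooth p) hu hv)
  have h4 := hS.inner_τ (mfderiv J I f p u) (mfderiv J I f p v)
  have h5 := S.inner_φ_left (mfderiv J I f p u) (mfderiv J I f p v)
  rw [hf.η_mfderiv, map_sub] at h3
  simp only [S.inner_ξ_right, FiberBundle.extend_apply_self, map_sub] at h1 h2 h3
  rw [g.symm] at h4 h5
  linarith

lemma eq_zero_of_inner (hf : S.IsLegendrian gN f) (hS : S.IsContactMetric)
    {v : TangentSpace I (f p)} (h0 : S.η (f p) v = 0)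
    (h1 : ∀ w, g.inner (f p) v (mfderiv J I f p w) = 0)
    (h2 : ∀ w, g.inner (f p) v (S.φ (f p) (mfderiv J I f p w)) = 0) : v = 0 := by
  -- Ψ is the sum map TN ⊕ φTN ⊕ ℝξ → TM. Orthogonality of the summands makes it injective, and 2n +
  -- 1 = dim M makes it surjective.
  let D : TangentSpace J p →ₗ[ℝ] TangentSpace I (f p) := (mfderiv J I f p).toLinearMap
  let Ψ : (TangentSpace J p × TangentSpace J p) × ℝ →ₗ[ℝ] TangentSpace I (f p) :=
    (D.coprod ((S.φ (f p)).toLinearMap ∘ₗ D)).coprod (LinearMap.toSpanSingleton ℝ _ (S.ξ (f p)))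
  have hΨ (a b c) : Ψ ((a, b), c) = mfderiv J I f p a + S.φ (f p) (mfderiv J I f p b) +
      c • S.ξ (f p) := rfl
  have hinj : Function.Injective Ψ := by
    refine (injective_iff_map_eq_zero _).2 ?_
    rintro ⟨⟨a, b⟩, c⟩ h
    rw [hΨ] at h
    have e1 := congrArg (S.η (f p)) h
    have e2 := congrArg (fun v ↦ g.inner (f p) v (mfderiv J I f p a)) h
    have e3 := congrArg (fun v ↦ g.inner (f p) v (S.φ (f p) (mfderiv J I f p b))) h
    simp only [map_add, add_apply, map_smul, smul_apply, S.inner_ξ_left, hf.η_mfderiv, S.η_φ,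
      S.η_ξ, hf.inner_φ_mfderiv hS, hf.isometric, S.compat, S.inner_φ_left, map_zero, zero_apply,
      smul_eq_mul, mul_one, mul_zero, add_zero, zero_add, neg_zero, sub_zero] at e1 e2 e3
    rw [e1, gN.eq_zero_of_inner_self e2, gN.eq_zero_of_inner_self e3]
    rfl
  have hdim : Module.finrank ℝ ((TangentSpace J p × TangentSpace J p) × ℝ) =
      Module.finrank ℝ (TangentSpace I (f p)) := by
    rw [Module.finrank_prod, Module.finrank_prod, Module.finrank_self]
    change Module.finrank ℝ E' + Module.finrank ℝ E' + 1 = Module.finrank ℝ E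
    rw [hf.dim, two_mul]
  obtain ⟨⟨⟨a, b⟩, c⟩, h⟩ :=
    (LinearMap.injective_iff_surjective_of_finrank_eq_finrank hdim).1 hinj v
  apply g.eq_zero_of_inner_self
  nth_rewrite 2 [← h]
  rw [hΨ, map_add, map_add, h1, h2, map_smul, S.inner_ξ_right, h0]
  simp

/-- For v normal, possibly with a ξ component, φv is orthogonal to ξ and to φTN, since g(φv, φw) =
g(v, w) for w tangent. Only the TN component is left. -/
lemma mfderiv_tangential_φ (hf : S.IsLegendrian gN f) (hS : S.IsContactMetric)
    {v : TangentSpace I (f p)} (hv : ∀ w, g.inner (f p) v (mfderiv J I f p w) = 0) :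
    mfderiv J I f p (tangential g gN f p (S.φ (f p) v)) = S.φ (f p) v := by
  rw [← sub_eq_zero]
  refine hf.eq_zero_of_inner hS ?_ (fun w ↦ ?_) fun w ↦ ?_
  · rw [map_sub, hf.η_mfderiv, S.η_φ, sub_zero]
  · rw [map_sub, sub_apply, hf.isometric, inner_tangential, sub_self]
  · rw [map_sub, sub_apply, hf.inner_φ_mfderiv hS, S.compat, hv, hf.η_mfderiv]
    simp

lemma h_mfderiv (hf : S.IsLegendrian gN f) (hS : S.IsContactMetric) (u : TangentSpace J p) :
    S.h (f p) (mfderiv J I f p u) = mfderiv J I f p (S.h₁ gN f p u) +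
      S.φ (f p) (mfderiv J I f p (S.h₂ gN f p u)) := by
  have h1 (w) : g.inner (f p) (S.h (f p) (mfderiv J I f p u) - mfderiv J I f p (S.h₁ gN f p u))
      (mfderiv J I f p w) = 0 := by
    rw [map_sub, sub_apply, hf.isometric, h₁, ContinuousLinearMap.comp_apply, inner_tangential,
      ContinuousLinearMap.comp_apply, sub_self]
  have h2 := hf.mfderiv_tangential_φ hS h1
  have h3 : S.h₂ gN f p u = -tangential g gN f p (S.φ (f p)
    (S.h (f p) (mfderiv J I f p u) - mfderiv J I f p (S.h₁ gN f p u))) := rfl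
  rw [h3, map_neg, map_neg, h2, S.φ_φ_of_horizontal, neg_neg, add_sub_cancel]
  rw [map_sub, hS.η_h, hf.η_mfderiv, sub_zero]

lemma mfderiv_tangential_φ_secondFF (hf : S.IsLegendrian gN f) (hS : S.IsContactMetric)
    (hX : SmoothAt X p) (hY : SmoothAt Y p) :
    mfderiv J I f p (tangential g gN f p (S.φ (f p) (secondFF g gN f X Y p))) =
      S.φ (f p) (secondFF g gN f X Y p) :=
  hf.mfderiv_tangential_φ hS (inner_secondFF (hf.smooth p) hf.isometric hX hY)

lemma secondFF_eq (hf : S.IsLegendrian gN f) (hS : S.IsContactMetric)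
    (hX : SmoothAt X p) (hY : SmoothAt Y p) :
    secondFF g gN f X Y p = -S.φ (f p) (mfderiv J I f p
      (tangential g gN f p (S.φ (f p) (secondFF g gN f X Y p)))) +
        S.η (f p) (secondFF g gN f X Y p) • S.ξ (f p) := by
  rw [hf.mfderiv_tangential_φ_secondFF hS hX hY, S.φ_sq]
  module

/-- As τ = hφ with h self-adjoint, g(Y, τX) = g(hY, φX), in which only the φh₂Y part of hY
contributes. -/
lemma inner_secondFF_ξ (hf : S.IsLegendrian gN f) (hS : S.IsContactMetric) (hY : SmoothAt Y p) :
    g.inner (f p) (secondFF g gN f X Y p) (S.ξ (f p)) + gN.inner p (X p) (S.h₂ gN f p (Y p)) = 0 := by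
  have h1 := hf.inner_covDerivAlong_ξ hY (X p)
  rw [covDerivAlong_mfderiv (gN := gN), map_add, add_apply, S.inner_ξ_right, hf.η_mfderiv, map_sub,
    hf.inner_φ_mfderiv hS, hS.τ_eq, ← hS.inner_h, hf.h_mfderiv hS, map_add, add_apply,
    hf.inner_φ_mfderiv hS, S.compat, hf.η_mfderiv, hf.isometric, gN.symm] at h1
  linarith

/-- Computes ∇_X(hY) twice, by the Leibniz rule for h and from hY = h₁Y + φh₂Y. -/
lemma covDerivAlong_h_mfderiv (hf : S.IsLegendrian gN f) (hS : S.IsContactMetric)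
    (hX : SmoothAt X p) (hY : SmoothAt Y p) :
    nablaEndo g S.h (f p) (mfderiv J I f p (X p)) (mfderiv J I f p (Y p)) +
        S.φ (f p) (mfderiv J I f p (S.h₁ gN f p
          (tangential g gN f p (S.φ (f p) (secondFF g gN f X Y p))))) -
        mfderiv J I f p (S.h₂ gN f p
          (tangential g gN f p (S.φ (f p) (secondFF g gN f X Y p)))) =
      mfderiv J I f p (covDerivEndo gN (S.h₁ gN f) X Y p) +
        secondFF g gN f X (fun q ↦ S.h₁ gN f q (Y q)) p +
        nablaEndo g S.φ (f p) (mfderiv J I f p (X p)) (mfderiv J I f p (S.h₂ gN f p (Y p))) +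
        S.φ (f p) (mfderiv J I f p (covDerivEndo gN (S.h₂ gN f) X Y p)) +
        S.φ (f p) (secondFF g gN f X (fun q ↦ S.h₂ gN f q (Y q)) p) := by
  have hY₁ := smoothAt_h₁ (S := S) (gN := gN) (hf.smooth p) hY
  have hY₂ := smoothAt_h₂ (S := S) (gN := gN) (hf.smooth p) hY
  have e1 := covDerivAlong_endo (g := g) (contMDiffAt_endo fun _ ↦ smoothAt_h (S := S))
    (alongDiffAt_mfderiv (hf.smooth p) hY) (X p)
  have e2 := covDerivAlong_endo (g := g) (S.smooth_φ (f p))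
    (alongDiffAt_mfderiv (hf.smooth p) hY₂) (X p)
  simp only [hf.h_mfderiv hS] at e1
  rw [covDerivAlong_add (alongDiffAt_mfderiv (hf.smooth p) hY₁)
    ((alongDiffAt_mfderiv (hf.smooth p) hY₂).endo (S.smooth_φ (f p))), e2] at e1
  -- Write σ = -φT + η(σ)ξ with T = φσ tangent; then hσ = φhT, because hφ = -φh and hξ = 0.
  have e3 : S.h (f p) (secondFF g gN f X Y p) =
      S.φ (f p) (mfderiv J I f p (S.h₁ gN f p
          (tangential g gN f p (S.φ (f p) (secondFF g gN f X Y p))))) -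
        mfderiv J I f p (S.h₂ gN f p
          (tangential g gN f p (S.φ (f p) (secondFF g gN f X Y p)))) := by
    conv_lhs => rw [hf.secondFF_eq hS hX hY]
    rw [map_add, map_neg, map_smul, hS.h_ξ, hS.h_φ, hf.h_mfderiv hS, map_add,
      S.φ_φ_of_horizontal (hf.η_mfderiv _)]
    module
  simp only [covDerivAlong_mfderiv (gN := gN), map_add, hf.h_mfderiv hS, e3] at e1
  simp only [covDerivEndo, map_sub]
  rw [← sub_eq_zero] at e1 ⊢
  rw [← neg_eq_zero, ← e1]
  module

end IsLegendrian

namespace IsKappaMuSpace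

variable {κ μ : ℝ}

/-- The TN component of `covDerivAlong_h_mfderiv`: all ∇h and ∇φ terms have horizontal arguments,
while σ and φTN are normal. -/
lemma covDerivEndo_h₁ (hS : S.IsKappaMuSpace κ μ) (hf : S.IsLegendrian gN f)
    (hX : SmoothAt X p) (hY : SmoothAt Y p) :
    covDerivEndo gN (S.h₁ gN f) X Y p =
      -tangential g gN f p (S.φ (f p) (secondFF g gN f X (fun q ↦ S.h₂ gN f q (Y q)) p)) -
        S.h₂ gN f p (tangential g gN f p (S.φ (f p) (secondFF g gN f X Y p))) := by
  have hC := hS.contact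
  refine gN.ext_inner fun w ↦ ?_
  have h1 := congrArg (fun v ↦ g.inner (f p) v (mfderiv J I f p w))
    (hf.covDerivAlong_h_mfderiv hC hX hY)
  simp only [map_add, map_sub, add_apply, sub_apply, S.inner_φ_left (mfderiv J I f p _),
    hf.inner_φ_mfderiv hC, hf.isometric,
    hS.inner_nablaEndo_h_eq_zero (hf.η_mfderiv _) (hf.η_mfderiv _) (hf.η_mfderiv _),
    (hS.inner_nablaEndo_eq_zero (hf.η_mfderiv _) (hf.η_mfderiv _) (hf.η_mfderiv _)).1,
    inner_secondFF (hf.smooth p) hf.isometric hX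
      (smoothAt_h₁ (S := S) (gN := gN) (hf.smooth p) hY)] at h1
  simp only [map_sub, map_neg, sub_apply, neg_apply, inner_tangential (gN := gN) f p (S.φ (f p) _)]
  linarith

/-- The φTN component of the same identity; φσ(X,h₂Y) disappears because it is tangent. -/
lemma covDerivEndo_h₂ (hS : S.IsKappaMuSpace κ μ) (hf : S.IsLegendrian gN f)
    (hX : SmoothAt X p) (hY : SmoothAt Y p) :
    covDerivEndo gN (S.h₂ gN f) X Y p =
      tangential g gN f p (S.φ (f p) (secondFF g gN f X (fun q ↦ S.h₁ gN f q (Y q)) p)) +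
        S.h₁ gN f p (tangential g gN f p (S.φ (f p) (secondFF g gN f X Y p))) := by
  have hC := hS.contact
  have hY₂ := smoothAt_h₂ (S := S) (gN := gN) (hf.smooth p) hY
  refine gN.ext_inner fun w ↦ ?_
  have h1 := congrArg (fun v ↦ g.inner (f p) v (S.φ (f p) (mfderiv J I f p w)))
    (hf.covDerivAlong_h_mfderiv hC hX hY)
  simp only [map_add, map_sub, add_apply, sub_apply, S.compat, hf.η_mfderiv,
    hf.inner_φ_mfderiv hC, hf.isometric,
    hS.inner_nablaEndo_h_eq_zero (hf.η_mfderiv _) (hf.η_mfderiv _) (S.η_φ _),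
    (hS.inner_nablaEndo_eq_zero (hf.η_mfderiv _) (hf.η_mfderiv _) (S.η_φ _)).1,
    inner_secondFF (hf.smooth p) hf.isometric hX hY₂] at h1
  rw [map_add, add_apply, inner_tangential, S.inner_φ_left]
  linarith

end IsKappaMuSpace
end AlmostContactMetric

end

end
end ContactGeometry

theorem mainTheorem4 (n : ℕ)
    {M : Type*} [TopologicalSpace M] [ChartedSpace (EuclideanSpace ℝ (Fin (2 * n + 1))) M]
    [IsManifold (𝓡 (2 * n + 1)) ∞ M]
    {N : Type*} [TopologicalSpace N] [ChartedSpace (EuclideanSpace ℝ (Fin n)) N]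
    [IsManifold (𝓡 n) ∞ N]
    (g : Metric (𝓡 (2 * n + 1)) M) (gN : Metric (𝓡 n) N)
    (S : AlmostContactMetric g) (κ μ : ℝ) (hS : S.IsKappaMuSpace κ μ)
    (f : N → M) (hf : S.IsLegendrian gN f) :
    -- the decomposition `hX = h₁X + φh₂X`
    (∀ (p : N) (u : TangentSpace (𝓡 n) p),
      S.h (f p) (mfderiv (𝓡 n) (𝓡 (2 * n + 1)) f p u) =
        mfderiv (𝓡 n) (𝓡 (2 * n + 1)) f p (S.h₁ gN f p u) +
          S.φ (f p) (mfderiv (𝓡 n) (𝓡 (2 * n + 1)) f p (S.h₂ gN f p u))) ∧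
    ∀ (p : N) (X Y : Π q : N, TangentSpace (𝓡 n) q), SmoothAt X p → SmoothAt Y p →
      -- `h₁Y` and `h₂Y` are smooth, and `φσ(X,Y)` is tangent
      SmoothAt (fun q ↦ S.h₁ gN f q (Y q)) p ∧
      SmoothAt (fun q ↦ S.h₂ gN f q (Y q)) p ∧
      mfderiv (𝓡 n) (𝓡 (2 * n + 1)) f p
        (tangential g gN f p (S.φ (f p) (secondFF g gN f X Y p))) =
          S.φ (f p) (secondFF g gN f X Y p) ∧
      -- `(∇̄_X h₁)Y = -φσ(X,h₂Y) - h₂φσ(X,Y)`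
      mfderiv (𝓡 n) (𝓡 (2 * n + 1)) f p (covDerivEndo gN (S.h₁ gN f) X Y p) =
        -S.φ (f p) (secondFF g gN f X (fun q ↦ S.h₂ gN f q (Y q)) p) -
          mfderiv (𝓡 n) (𝓡 (2 * n + 1)) f p
            (S.h₂ gN f p (tangential g gN f p (S.φ (f p) (secondFF g gN f X Y p)))) ∧
      -- `(∇̄_X h₂)Y = φσ(X,h₁Y) + h₁φσ(X,Y)`
      mfderiv (𝓡 n) (𝓡 (2 * n + 1)) f p (covDerivEndo gN (S.h₂ gN f) X Y p) =
        S.φ (f p) (secondFF g gN f X (fun q ↦ S.h₁ gN f q (Y q)) p) +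
          mfderiv (𝓡 n) (𝓡 (2 * n + 1)) f p
            (S.h₁ gN f p (tangential g gN f p (S.φ (f p) (secondFF g gN f X Y p)))) ∧
      -- `g(σ(X,Y),ξ) + g(X,h₂Y) = 0`
      g.inner (f p) (secondFF g gN f X Y p) (S.ξ (f p)) +
        gN.inner p (X p) (S.h₂ gN f p (Y p)) = 0 := by
  have hC := hS.contact
  refine ⟨fun p u ↦ hf.h_mfderiv hC u, fun p X Y hX hY ↦ ?_⟩
  have hY₁ := AlmostContactMetric.smoothAt_h₁ (S := S) (gN := gN) (hf.smooth p) hY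
  have hY₂ := AlmostContactMetric.smoothAt_h₂ (S := S) (gN := gN) (hf.smooth p) hY
  refine ⟨hY₁, hY₂, hf.mfderiv_tangential_φ_secondFF hC hX hY, ?_, ?_,
    hf.inner_secondFF_ξ hC hY⟩
  · rw [hS.covDerivEndo_h₁ hf hX hY, map_sub, map_neg,
      hf.mfderiv_tangential_φ_secondFF hC hX hY₂]
  · rw [hS.covDerivEndo_h₂ hf hX hY, map_add, hf.mfderiv_tangential_φ_secondFF hC hX hY₁]
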